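/- Let $\nu$ be a Borel probability measure on $\mathbb{R}$ with compact topological support, let $\Omega = (\operatorname{supp}\nu)^{\mathbb{Z}}$ and $\mu = \nu^{\mathbb{Z}}$ (the product measure on $\Omega$). Throughout, $\|\cdot\|$ is the operator norm of a $2\times 2$ matrix acting on the Euclidean plane. **Discrete case.** For $\omega\in\Omega$ let $V_\omega(n)=\omega_n$, $n \in \mathbb{Z}$. For every $E\in\mathbb{R}$, $\omega \in \Omega$ and $n\in\mathbb{Z}$ there is a unique real $2\times 2$ matrix $M_{E,\omega}(n)$ (the transfer matrix) such that $$\begin{pmatrix} u(n+1)\\ u(n)\end{pmatrix}=M_{E,\omega}(n)\begin{pmatrix} u(1)\\ u(0)\end{pmatrix}$$ for every real solution $u$ on $\mathbb{Z}$ of $u(m+1)+u(m-1)+V_\omega(m)u(m)=E\,u(m)$, $m\in\mathbb{Z}$. For every $E\in\mathbb{R}$ there is a constant $\gamma(E)\ge 0$ such that for $\mu$-almost every $\omega\in\Omega$, $$\lim_{n\to\infty}\frac1n\log\|M_{E,\omega}(n)\|=\gamma(E).$$ In particular, for these $\omega$, the operator $[H_\omega\psi](n)=\psi(n+1)+\psi(n-1)+V_\omega(n)\psi(n)$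 has Lyapunov behavior at energy $E$ (that is, the limit $\gamma_\omega(E):=\lim_{n\to\infty}\frac1n\log\|M_{E,\omega}(n)\|$ exists), and $\gamma_\omega(E)=\gamma(E)$. **Continuum case.** Let moreover $v\in L^1(0,1)$ be real-valued and non-zero in $L^1(0,1)$, extended by zero to $\mathbb{R}$, and let $V_\omega(x)=\sum_{n\in\mathbb{Z}}\omega_n v(x-n)$. For every $E\in\mathbb{R}$, $\omega \in \Omega$ and $x\in\mathbb{R}$ there is a unique real $2\times 2$ matrix $M_{E,\omega}(x)$ such that $$\begin{pmatrix} u'(x)\\ u(x)\end{pmatrix}=M_{E,\omega}(x)\begin{pmatrix} u'(0)\\ u(0)\end{pmatrix}$$ for every real solution $u$ of $-u''+V_\omega u=Eu$ on $\mathbb{R}$ (meaning that $u$ is differentiable, $u'$ is locally absolutely continuous, and the equation holds almost everywhere). For every $E\in\mathbb{R}$ there is a constant $\gamma(E)\ge 0$ such that for $\mu$-almost every $\omega\in\Omega$, $$\lim_{x\to\infty}\frac1x\log\|M_{E,\omega}(x)\|=\gamma(E),$$ where $x \to \infty$ through the reals. In particular, for these $\omega$, the operator $H_\omega\psi=-\psi''+V_\omega\psi$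 has Lyapunov behavior at energy $E$ (that is, the limit $\gamma_\omega(E):=\lim_{x\to\infty}\frac1x\log\|M_{E,\omega}(x)\|$ exists), and $\gamma_\omega(E)=\gamma(E)$. -/

import Mathlib

open MeasureTheory Filter Set Topology

noncomputable section

namespace Anderson

/-! ### The probability space -/

/-- The space of coupling sequences: two-sided sequences with values in the topological
support of the single-site distribution. -/
abbrev Omega (ν : Measure ℝ) : Type := ℤ → ν.support

/-- The single-site distribution, viewed as a measure on its topological support. -/
def siteMeasure (ν : Measure ℝ) : Measure ν.support :=
  Measure.comap (fun x : ν.support => (x : ℝ)) ν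

instance siteMeasure_isProbabilityMeasure (ν : Measure ℝ) [IsProbabilityMeasure ν] :
    IsProbabilityMeasure (siteMeasure ν) := by
  have hm : MeasurableSet ν.support := Measure.isClosed_support.measurableSet
  constructor
  unfold siteMeasure
  rw [comap_subtype_coe_apply hm, image_univ, Subtype.range_coe]
  exact prob_compl_eq_zero_iff hm |>.1 Measure.measure_compl_support

/-- The two-sided infinite product of the single-site distribution. -/
def mu (ν : Measure ℝ) : Measure (Omega ν) :=
  Measure.infinitePi fun _ : ℤ => siteMeasure ν

/-- The operator norm of a `2 × 2` matrix acting on the Euclidean plane. -/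
def opNorm (M : Matrix (Fin 2) (Fin 2) ℝ) : ℝ :=
  ‖Matrix.toEuclideanCLM (n := Fin 2) (𝕜 := ℝ) M‖

/-! ### The discrete case -/

namespace Discrete

/-- The potential `V_ω(n) = ω_n`. -/
def potential {ν : Measure ℝ} (ω : Omega ν) : ℤ → ℝ := fun n => (ω n : ℝ)

/-- `u` solves `u(n+1) + u(n-1) + V(n) u(n) = E u(n)` on `ℤ`. -/
def IsSolution (V : ℤ → ℝ) (E : ℝ) (u : ℤ → ℝ) : Prop :=
  ∀ n : ℤ, u (n + 1) + u (n - 1) + V n * u n = E * u n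

/-- `M` maps the data `(u(1), u(0))` to `(u(n+1), u(n))` for every solution `u`. -/
def IsTransferMatrix (V : ℤ → ℝ) (E : ℝ) (n : ℤ) (M : Matrix (Fin 2) (Fin 2) ℝ) : Prop :=
  ∀ u : ℤ → ℝ, IsSolution V E u → ![u (n + 1), u n] = M.mulVec ![u 1, u 0]

/-- The transfer matrix from the origin to `n`, i.e. the matrix with the property
`IsTransferMatrix`. -/
def transferMatrix (V : ℤ → ℝ) (E : ℝ) (n : ℤ) : Matrix (Fin 2) (Fin 2) ℝ :=
  Classical.epsilon (IsTransferMatrix V E n)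

/-- `(1/n) log ‖M(n)‖`. -/
def growthRate (V : ℤ → ℝ) (E : ℝ) (n : ℕ) : ℝ :=
  1 / (n : ℝ) * Real.log (opNorm (transferMatrix V E n))

/-- The operator with potential `V` has Lyapunov behavior at energy `E`: the limit of
`(1/n) log ‖M(n)‖` as `n → ∞` exists (as a real number). -/
def HasLyapunovBehavior (V : ℤ → ℝ) (E : ℝ) : Prop :=
  ∃ l : ℝ, Tendsto (growthRate V E) atTop (𝓝 l)

/-- The limit of `(1/n) log ‖M(n)‖`, when it exists. -/
def lyapunovExponent (V : ℤ → ℝ) (E : ℝ) : ℝ := limUnder atTop (growthRate V E)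

end Discrete

/-! ### The continuum case -/

namespace Continuum

/-- The potential `V_ω(x) = ∑ₙ ω_n v(x - n)`, where the single-site potential `v` on `(0,1)` is
extended by zero; at most one summand is non-zero. -/
def potential {ν : Measure ℝ} (v : ℝ → ℝ) (ω : Omega ν) : ℝ → ℝ :=
  fun x => ∑' n : ℤ, (ω n : ℝ) * (Ioo (0 : ℝ) 1).indicator v (x - n)

/-- `u` solves `-u'' + V u = E u` on `ℝ`: `u` is differentiable, `u'` is locally absolutely
continuous, and the equation holds almost everywhere. -/
def IsSolution (V : ℝ → ℝ) (E : ℝ) (u : ℝ → ℝ) : Prop :=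
  Differentiable ℝ u ∧ (∀ a b : ℝ, AbsolutelyContinuousOnInterval (deriv u) a b) ∧
    ∀ᵐ x : ℝ, -deriv (deriv u) x + V x * u x = E * u x

/-- `M` maps the data `(u'(0), u(0))` to `(u'(x), u(x))` for every solution `u`. -/
def IsTransferMatrix (V : ℝ → ℝ) (E : ℝ) (x : ℝ) (M : Matrix (Fin 2) (Fin 2) ℝ) : Prop :=
  ∀ u : ℝ → ℝ, IsSolution V E u → ![deriv u x, u x] = M.mulVec ![deriv u 0, u 0]

/-- The transfer matrix from the origin to `x`, i.e. the matrix with the property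
`IsTransferMatrix`. -/
def transferMatrix (V : ℝ → ℝ) (E : ℝ) (x : ℝ) : Matrix (Fin 2) (Fin 2) ℝ :=
  Classical.epsilon (IsTransferMatrix V E x)

/-- `(1/x) log ‖M(x)‖`. -/
def growthRate (V : ℝ → ℝ) (E : ℝ) (x : ℝ) : ℝ :=
  1 / x * Real.log (opNorm (transferMatrix V E x))

/-- The operator with potential `V` has Lyapunov behavior at energy `E`: the limit of
`(1/x) log ‖M(x)‖` as `x → ∞` through the reals exists (as a real number). -/
def HasLyapunovBehavior (V : ℝ → ℝ) (E : ℝ) : Prop :=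
  ∃ l : ℝ, Tendsto (growthRate V E) atTop (𝓝 l)

/-- The limit of `(1/x) log ‖M(x)‖`, when it exists. -/
def lyapunovExponent (V : ℝ → ℝ) (E : ℝ) : ℝ := limUnder atTop (growthRate V E)

end Continuum

end Anderson

end

/-! Both cases are the Furstenberg–Kesten theorem for products of i.i.d. unimodular matrices with
bounded norms. The transfer matrix over n cells is such a product, so log‖M(n)‖ is a subadditive
cocycle over the shift. Since a 2×2 matrix of determinant one satisfies ‖M⁻¹‖ ≤ ‖M‖, this cocycle is
nonnegative and dropping its first factor changes it by a bounded amount.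

The subadditive limit is obtained from independence, without a general ergodic theorem. Let γ be the
limit of the means (1/n)∫ g n. Blocks of length m are i.i.d., so the strong law bounds the limsup of
g n / n a.e. by (∫ g m)/m, hence by γ (`limsup_le_of_indepFun`). For the other side, a greedy
covering of orbits by stretches on which the liminf is almost attained (`le_covering`) gives γ ≤ ∫
liminf (`lim_le_integral_lowerRate`). As liminf ≤ limsup ≤ γ a.e., all three agree a.e.

In the continuum the equation is the system p' = w u, u' = p with w = V - E merely locally
integrable. Its integral form is solved by successive approximations in a weighted norm; a Grönwall
bound then gives uniqueness, bounds on the one-cell propagator uniform over couplings, and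
continuity in the coupling. Constancy of the Wronskian gives determinant one. Integer points are
then covered by the matrix theorem, and real x differ from ⌊x⌋ by a bounded change of the logarithm
(`tendsto_div_of_tendsto_nat`). -/

noncomputable section

namespace Anderson

open ProbabilityTheory

/-! ### Bounded subadditive cocycles -/

/-- A nonnegative subadditive cocycle over `T` whose increments are bounded by `C`. -/
structure IsBoundedSubadditive {Ω : Type*} (T : Ω → Ω) (g : ℕ → Ω → ℝ) (C : ℝ) : Prop where
  zero : ∀ ω, g 0 ω = 0
  nonneg : ∀ n ω, 0 ≤ g n ω
  add_le : ∀ m n ω, g (m + n) ω ≤ g m ω + g n (T^[m] ω)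
  one_le : ∀ ω, g 1 ω ≤ C
  comp_le : ∀ n ω, g n (T ω) ≤ g (n + 1) ω + C

/-- The lower growth rate of a subadditive cocycle. -/
def lowerRate {Ω : Type*} (g : ℕ → Ω → ℝ) (ω : Ω) : ℝ :=
  liminf (fun n : ℕ => g n ω / n) atTop

namespace IsBoundedSubadditive

variable {Ω : Type*} {T : Ω → Ω} {g : ℕ → Ω → ℝ} {C : ℝ}

lemma bound_nonneg [Nonempty Ω] (h : IsBoundedSubadditive T g C) : 0 ≤ C :=
  (h.nonneg 1 (Classical.arbitrary Ω)).trans (h.one_le _)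

lemma le_mul (h : IsBoundedSubadditive T g C) (n : ℕ) (ω : Ω) : g n ω ≤ n * C := by
  induction n generalizing ω with
  | zero => simp [h.zero]
  | succ n ih =>
    have h1 := h.add_le n 1 ω
    have h2 := h.one_le (T^[n] ω)
    have h3 := ih ω
    push_cast
    linarith

lemma div_nonneg (h : IsBoundedSubadditive T g C) (n : ℕ) (ω : Ω) : 0 ≤ g n ω / n :=
  _root_.div_nonneg (h.nonneg n ω) n.cast_nonneg

lemma div_le (h : IsBoundedSubadditive T g C) (n : ℕ) (ω : Ω) : g n ω / n ≤ C := by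
  have : Nonempty Ω := ⟨ω⟩
  exact div_le_of_le_mul₀ n.cast_nonneg h.bound_nonneg (by linarith [h.le_mul n ω])

lemma isBoundedUnder_le (h : IsBoundedSubadditive T g C) (ω : Ω) :
    IsBoundedUnder (· ≤ ·) atTop fun n : ℕ => g n ω / n :=
  isBoundedUnder_of ⟨C, fun n => h.div_le n ω⟩

lemma isBoundedUnder_ge (h : IsBoundedSubadditive T g C) (ω : Ω) :
    IsBoundedUnder (· ≥ ·) atTop fun n : ℕ => g n ω / n :=
  isBoundedUnder_of ⟨0, fun n => h.div_nonneg n ω⟩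

lemma lowerRate_nonneg (h : IsBoundedSubadditive T g C) (ω : Ω) : 0 ≤ lowerRate g ω :=
  le_liminf_of_le (h.isBoundedUnder_le ω).isCoboundedUnder_ge
    (Eventually.of_forall fun n => h.div_nonneg n ω)

lemma lowerRate_le (h : IsBoundedSubadditive T g C) (ω : Ω) : lowerRate g ω ≤ C :=
  liminf_le_of_frequently_le (Frequently.of_forall fun n => h.div_le n ω)
    (h.isBoundedUnder_ge ω)

lemma exists_lt (h : IsBoundedSubadditive T g C) (ω : Ω) {ε : ℝ} (hε : 0 < ε) :
    ∃ n : ℕ, 1 ≤ n ∧ g n ω < n * (lowerRate g ω + ε) := by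
  have hf : ∃ᶠ n : ℕ in atTop, g n ω / n < lowerRate g ω + ε :=
    frequently_lt_of_liminf_lt (h.isBoundedUnder_le ω).isCoboundedUnder_ge
      (lt_add_of_pos_right _ hε)
  obtain ⟨n, hn, hn1⟩ := (hf.and_eventually (eventually_ge_atTop 1)).exists
  refine ⟨n, hn1, ?_⟩
  rw [div_lt_iff₀ (by positivity)] at hn
  linarith

/-- By `comp_le`, dropping the first step costs at most C, which is negligible after division by n.
This one-sided invariance is all that the covering argument needs. -/
lemma lowerRate_comp_le (h : IsBoundedSubadditive T g C) (ω : Ω) :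
    lowerRate g (T ω) ≤ lowerRate g ω := by
  refine le_of_forall_pos_le_add fun ε hε => ?_
  have hf : ∃ᶠ n : ℕ in atTop, g n ω / n < lowerRate g ω + ε / 2 :=
    frequently_lt_of_liminf_lt (h.isBoundedUnder_le ω).isCoboundedUnder_ge
      (lt_add_of_pos_right _ (half_pos hε))
  refine liminf_le_of_frequently_le ?_ (h.isBoundedUnder_ge _)
  -- For m ≥ N the spare ε/2 per step pays for the extra step from m to m + 1 and for the constant
  -- C.
  obtain ⟨N, hN⟩ := exists_nat_gt ((lowerRate g ω + ε + C) / (ε / 2))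
  have hf' := hf.and_eventually (eventually_ge_atTop (N + 2))
  rw [frequently_atTop] at hf' ⊢
  intro a
  obtain ⟨b, hb, hlt, hbN⟩ := hf' (a + 1)
  obtain ⟨m, rfl⟩ : ∃ m, b = m + 1 := ⟨b - 1, by omega⟩
  refine ⟨m, by omega, ?_⟩
  have hm : (0 : ℝ) < m := by exact_mod_cast (by omega : 0 < m)
  have hNm : (N : ℝ) ≤ m := by exact_mod_cast (by omega : N ≤ m)
  rw [div_lt_iff₀ (by positivity)] at hlt
  rw [div_le_iff₀ hm]
  rw [div_lt_iff₀ (by positivity)] at hN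
  have h1 := h.comp_le m ω
  push_cast at hlt
  nlinarith

lemma lowerRate_iterate_le (h : IsBoundedSubadditive T g C) (n : ℕ) (ω : Ω) :
    lowerRate g (T^[n] ω) ≤ lowerRate g ω := by
  induction n with
  | zero => rfl
  | succ n ih =>
    rw [Function.iterate_succ_apply']
    exact (h.lowerRate_comp_le _).trans ih

/-- The set of points where the lower rate is not nearly attained within `N` steps. -/
def slowSet (g : ℕ → Ω → ℝ) (ε : ℝ) (N : ℕ) : Set Ω :=
  {ω | ∀ n, 1 ≤ n → n ≤ N → n * (lowerRate g ω + ε) ≤ g n ω}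

/-- Greedy covering of an orbit segment: at a slow point advance one step at cost C, charged to the
indicator sum; elsewhere jump some n ≤ N steps at cost below n * (rate + ε). Once at most N steps
remain, they cost at most N * C together. Rates at later points are replaced by the rate at the
start, because the lower rate does not increase along orbits. -/
lemma le_covering (h : IsBoundedSubadditive T g C) {ε : ℝ} (hε : 0 < ε) (N L : ℕ) (ω : Ω) :
    g L ω ≤ L * (lowerRate g ω + ε) +
      C * ∑ i ∈ Finset.range L, (slowSet g ε N).indicator 1 (T^[i] ω) + N * C := by
  have : Nonempty Ω := ⟨ω⟩
  have hC := h.bound_nonneg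
  induction L using Nat.strong_induction_on generalizing ω with
  | _ L ih =>
  have hf := h.lowerRate_nonneg ω
  have hind : ∀ ω, 0 ≤ (slowSet g ε N).indicator (1 : Ω → ℝ) ω := fun ω =>
    indicator_nonneg (fun _ _ => zero_le_one) _
  have hsum : ∀ (K : ℕ) (ω : Ω),
      0 ≤ ∑ i ∈ Finset.range K, (slowSet g ε N).indicator (1 : Ω → ℝ) (T^[i] ω) := fun K ω =>
    Finset.sum_nonneg fun i _ => hind _
  rcases le_or_gt L N with hLN | hLN
  · have h1 := h.le_mul L ω
    have h2 : (L : ℝ) * C ≤ N * C := by gcongr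
    have h3 : 0 ≤ L * (lowerRate g ω + ε) := by positivity
    have h4 := mul_nonneg hC (hsum L ω)
    linarith
  · by_cases hω : ω ∈ slowSet g ε N
    · obtain ⟨K, rfl⟩ : ∃ K, L = 1 + K := ⟨L - 1, by omega⟩
      have h1 := h.add_le 1 K ω
      have h2 := h.one_le ω
      have h3 := ih K (by omega) (T ω)
      have h4 := h.lowerRate_comp_le ω
      rw [Finset.sum_range_add]
      have h5 : (K : ℝ) * (lowerRate g (T ω) + ε) ≤ K * (lowerRate g ω + ε) := by gcongr
      simp only [Finset.range_one, Finset.sum_singleton, Function.iterate_zero, id,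
        indicator_of_mem hω, Pi.one_apply, Function.iterate_add_apply, Function.iterate_one,
        Nat.add_comm 1] at h1 ⊢
      push_cast
      nlinarith
    · simp only [slowSet, mem_ofPred_eq, not_forall, not_le] at hω
      obtain ⟨n, hn1, hnN, hlt⟩ := hω
      obtain ⟨K, rfl⟩ : ∃ K, L = n + K := ⟨L - n, by omega⟩
      have h1 := h.add_le n K ω
      have h3 := ih K (by omega) (T^[n] ω)
      have h4 := h.lowerRate_iterate_le n ω
      have h5 : (K : ℝ) * (lowerRate g (T^[n] ω) + ε) ≤ K * (lowerRate g ω + ε) := by gcongr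
      have h6 : ∀ i, T^[i] (T^[n] ω) = T^[n + i] ω := fun i => by
        rw [add_comm, Function.iterate_add_apply]
      simp only [h6] at h3
      rw [Finset.sum_range_add]
      have h7 := mul_nonneg hC (hsum n ω)
      push_cast
      linarith

lemma le_sum_blocks (h : IsBoundedSubadditive T g C) (m k r : ℕ) (ω : Ω) :
    g (k * m + r) ω ≤ ∑ j ∈ Finset.range k, g m (T^[j * m] ω) + r * C := by
  induction k generalizing r with
  | zero => simpa using h.le_mul r ω
  | succ k ih =>
    have h1 := h.add_le (k * m) (m + r) ω
    have h2 := h.add_le m r (T^[k * m] ω)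
    have h3 := h.le_mul r (T^[m] (T^[k * m] ω))
    have h4 : g (k * m) ω ≤ ∑ j ∈ Finset.range k, g m (T^[j * m] ω) := by simpa using ih 0
    rw [Finset.sum_range_succ, show (k + 1) * m + r = k * m + (m + r) by ring]
    linarith

/-! ### Integrated estimates and the almost sure limit. -/

variable [MeasurableSpace Ω] {μ : Measure Ω}

lemma measurable_lowerRate (hg : ∀ n, Measurable (g n)) : Measurable (lowerRate g) :=
  Measurable.liminf fun n => (hg n).div_const _

lemma measurableSet_slowSet (hg : ∀ n, Measurable (g n)) (ε : ℝ) (N : ℕ) :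
    MeasurableSet (slowSet g ε N) := by
  have : slowSet g ε N = ⋂ n : ℕ, ⋂ (_ : 1 ≤ n), ⋂ (_ : n ≤ N),
      {ω | n * (lowerRate g ω + ε) ≤ g n ω} := by
    ext; simp [slowSet]
  rw [this]
  refine MeasurableSet.iInter fun n => MeasurableSet.iInter fun _ => MeasurableSet.iInter fun _ => ?_
  exact measurableSet_le (((measurable_lowerRate hg).add_const _).const_mul _) (hg n)

lemma bddBelow_integral (h : IsBoundedSubadditive T g C) :
    BddBelow (range fun n : ℕ => (∫ ω, g n ω ∂μ) / n) :=
  ⟨0, by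
    rintro _ ⟨n, rfl⟩
    exact _root_.div_nonneg (integral_nonneg (h.nonneg n)) n.cast_nonneg⟩

variable [IsProbabilityMeasure μ]

lemma integrable (h : IsBoundedSubadditive T g C) (hg : ∀ n, Measurable (g n)) (n : ℕ) :
    Integrable (g n) μ :=
  Integrable.of_bound (hg n).aestronglyMeasurable (n * C) (Eventually.of_forall fun ω => by
    rw [Real.norm_of_nonneg (h.nonneg n ω)]; exact h.le_mul n ω)

lemma integrable_lowerRate (h : IsBoundedSubadditive T g C) (hg : ∀ n, Measurable (g n)) :
    Integrable (lowerRate g) μ :=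
  Integrable.of_bound (measurable_lowerRate hg).aestronglyMeasurable C
    (Eventually.of_forall fun ω => by
      rw [Real.norm_of_nonneg (h.lowerRate_nonneg ω)]; exact h.lowerRate_le ω)

/-- The slow sets decrease with N, and by `exists_lt` no point lies in all of them; continuity of
the measure from above applies. -/
lemma tendsto_measureReal_slowSet (h : IsBoundedSubadditive T g C) (hg : ∀ n, Measurable (g n))
    {ε : ℝ} (hε : 0 < ε) : Tendsto (fun N => μ.real (slowSet g ε N)) atTop (𝓝 0) := by
  have hanti : Antitone (slowSet g ε) := fun M N hMN ω hω n h1 h2 => hω n h1 (h2.trans hMN)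
  have hinter : ⋂ N, slowSet g ε N = ∅ := by
    refine eq_empty_of_forall_notMem fun ω hω => ?_
    obtain ⟨n, hn, hlt⟩ := h.exists_lt ω hε
    exact absurd (mem_iInter.1 hω n n hn le_rfl) (not_le.2 hlt)
  have := tendsto_measure_iInter_atTop (μ := μ)
    (fun N => (measurableSet_slowSet hg ε N).nullMeasurableSet) hanti ⟨0, measure_ne_top _ _⟩
  rw [hinter, measure_empty] at this
  exact (ENNReal.tendsto_toReal ENNReal.zero_ne_top).comp this

lemma integral_le_covering (h : IsBoundedSubadditive T g C) (hg : ∀ n, Measurable (g n))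
    (hT : MeasurePreserving T μ μ) {ε : ℝ} (hε : 0 < ε) (N L : ℕ) :
    ∫ ω, g L ω ∂μ ≤ L * (∫ ω, lowerRate g ω ∂μ + ε) + C * (L * μ.real (slowSet g ε N)) + N * C := by
  have hS := measurableSet_slowSet hg ε N
  have hi : ∀ i, Integrable (fun ω => (slowSet g ε N).indicator (1 : Ω → ℝ) (T^[i] ω)) μ := fun i =>
    ((hT.iterate i).integrable_comp_of_integrable
      ((integrable_const (1 : ℝ)).indicator hS))
  have hie : ∀ i, ∫ ω, (slowSet g ε N).indicator (1 : Ω → ℝ) (T^[i] ω) ∂μ =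
      μ.real (slowSet g ε N) := fun i => by
    rw [← integral_indicator_one hS]
    conv_rhs => rw [← (hT.iterate i).map_eq]
    rw [integral_map (hT.iterate i).measurable.aemeasurable]
    have hm : Measurable ((slowSet g ε N).indicator (1 : Ω → ℝ)) := measurable_one.indicator hS
    exact hm.aestronglyMeasurable
  have hl := h.integrable_lowerRate hg (μ := μ)
  have hs := integrable_finsetSum (Finset.range L) fun i _ => hi i
  refine (integral_mono (h.integrable hg L)
    ((((hl.add (integrable_const ε)).const_mul (L : ℝ)).add (hs.const_mul C)).add
      (integrable_const (N * C))) fun ω => h.le_covering hε N L ω).trans_eq ?_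
  simp only [Pi.add_apply]
  rw [integral_add _ (integrable_const _), integral_add _ (hs.const_mul C), integral_const_mul,
    integral_const_mul, integral_finsetSum _ fun i _ => hi i, integral_add hl (integrable_const _)]
  · simp [hie]
  · exact (hl.add (integrable_const ε)).const_mul _
  · exact ((hl.add (integrable_const ε)).const_mul _).add (hs.const_mul C)

lemma subadditive_integral (h : IsBoundedSubadditive T g C) (hg : ∀ n, Measurable (g n))
    (hT : MeasurePreserving T μ μ) : Subadditive fun n => ∫ ω, g n ω ∂μ := by
  intro m n
  have hc : ∫ ω, g n (T^[m] ω) ∂μ = ∫ ω, g n ω ∂μ := by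
    conv_rhs => rw [← (hT.iterate m).map_eq]
    rw [integral_map (hT.iterate m).measurable.aemeasurable (hg n).aestronglyMeasurable]
  have hi : Integrable (fun ω => g n (T^[m] ω)) μ :=
    (hT.iterate m).integrable_comp_of_integrable (h.integrable hg n (μ := μ))
  calc ∫ ω, g (m + n) ω ∂μ ≤ ∫ ω, (g m ω + g n (T^[m] ω)) ∂μ :=
        integral_mono (h.integrable hg _) ((h.integrable hg m).add hi) fun ω => h.add_le m n ω
    _ = _ := by rw [integral_add (h.integrable hg m) hi, hc]

/-- The integrated covering bound is divided by L. Letting L → ∞ removes the tail N * C, then N → ∞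
removes the slow set, and finally ε → 0. -/
lemma lim_le_integral_lowerRate (h : IsBoundedSubadditive T g C) (hg : ∀ n, Measurable (g n))
    (hT : MeasurePreserving T μ μ) :
    (h.subadditive_integral hg hT).lim ≤ ∫ ω, lowerRate g ω ∂μ := by
  refine le_of_forall_pos_le_add fun ε hε => ?_
  have key : ∀ N, (h.subadditive_integral hg hT).lim ≤
      (∫ ω, lowerRate g ω ∂μ + ε) + C * μ.real (slowSet g ε N) := by
    intro N
    have hlim : Tendsto (fun L : ℕ => (∫ ω, lowerRate g ω ∂μ + ε) + C * μ.real (slowSet g ε N) +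
        N * C / L) atTop
        (𝓝 ((∫ ω, lowerRate g ω ∂μ + ε) + C * μ.real (slowSet g ε N) + 0)) :=
      tendsto_const_nhds.add (tendsto_const_div_atTop_nhds_zero_nat _)
    rw [add_zero] at hlim
    refine ge_of_tendsto hlim ?_
    filter_upwards [eventually_gt_atTop 0] with L hL
    refine ((h.subadditive_integral hg hT).lim_le_div h.bddBelow_integral hL.ne').trans ?_
    have hL' : (0 : ℝ) < L := by exact_mod_cast hL
    rw [div_le_iff₀ hL']
    refine (h.integral_le_covering hg hT hε N L).trans_eq ?_
    field_simp
  have hlim := ((h.tendsto_measureReal_slowSet hg hε (μ := μ)).const_mul C).const_add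
    (∫ ω, lowerRate g ω ∂μ + ε)
  rw [mul_zero, add_zero] at hlim
  exact ge_of_tendsto' hlim key

/-- Cutting into blocks of length m bounds g n by a sum of i.i.d. terms plus a bounded remainder,
and the strong law evaluates the average of that sum. -/
lemma limsup_le_of_indepFun (h : IsBoundedSubadditive T g C) (hg : ∀ n, Measurable (g n))
    (hT : MeasurePreserving T μ μ) {m : ℕ} (hm : 1 ≤ m)
    (hind : Pairwise fun i j : ℕ =>
      IndepFun (fun ω => g m (T^[i * m] ω)) (fun ω => g m (T^[j * m] ω)) μ) :
    ∀ᵐ ω ∂μ, limsup (fun n : ℕ => g n ω / n) atTop ≤ (∫ ω, g m ω ∂μ) / m := by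
  have hmeas : ∀ i : ℕ, Measurable fun ω => g m (T^[i * m] ω) := fun i =>
    (hg m).comp (hT.iterate _).measurable
  have hid : ∀ i : ℕ, IdentDistrib (fun ω => g m (T^[i * m] ω)) (fun ω => g m (T^[0 * m] ω)) μ μ := by
    intro i
    refine ⟨(hmeas i).aemeasurable, (hmeas 0).aemeasurable, ?_⟩
    have : ∀ i : ℕ, μ.map (fun ω => g m (T^[i * m] ω)) = μ.map (g m) := fun i => by
      conv_rhs => rw [← (hT.iterate (i * m)).map_eq]
      rw [Measure.map_map (hg m) (hT.iterate _).measurable]; rfl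
    rw [this, this]
  have hint : Integrable (fun ω => g m (T^[0 * m] ω)) μ := by
    simpa using h.integrable hg m
  filter_upwards [strong_law_ae_real _ hint hind hid] with ω hω
  simp only [zero_mul, Function.iterate_zero, id] at hω
  -- With n = m * (n / m) + n % m, the number of blocks satisfies (n / m) / n → 1 / m, and the
  -- remainder contributes at most m * C / n.
  have hdiv : Tendsto (fun n : ℕ => n / m) atTop atTop := Nat.tendsto_div_const_atTop (by omega)
  have hratio : Tendsto (fun n : ℕ => ((n / m : ℕ) : ℝ) / n) atTop (𝓝 (1 / m)) := by
    have h1 := (tendsto_nat_floor_mul_div_atTop (R := ℝ) (a := 1 / m) (by positivity)).comp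
      (tendsto_natCast_atTop_atTop (R := ℝ))
    refine h1.congr fun n => ?_
    simp only [Function.comp]
    rw [one_div_mul_eq_div, Nat.floor_div_eq_div]
  have hlim := ((hω.comp hdiv).mul hratio).add
    (tendsto_const_div_atTop_nhds_zero_nat (m * C))
  rw [add_zero, mul_one_div] at hlim
  refine (limsup_le_limsup ?_ (h.isBoundedUnder_ge ω).isCoboundedUnder_le
    hlim.isBoundedUnder_le).trans_eq hlim.limsup_eq
  have hC : 0 ≤ C := (h.nonneg 1 ω).trans (h.one_le _)
  filter_upwards [eventually_ge_atTop m] with n hn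
  have hn0 : (0 : ℝ) < n := by exact_mod_cast (by omega : 0 < n)
  have hk0 : ((n / m : ℕ) : ℝ) ≠ 0 := by
    exact_mod_cast (Nat.div_pos hn (by omega)).ne'
  have h1 := h.le_sum_blocks m (n / m) (n % m) ω
  rw [mul_comm (n / m), Nat.div_add_mod] at h1
  have h2 : ((n % m : ℕ) : ℝ) * C ≤ m * C := by
    gcongr
    exact (Nat.mod_lt _ (by omega)).le
  simp only [Function.comp]
  rw [div_mul_div_cancel₀ hk0, ← add_div]
  gcongr
  linarith

/-- The subadditive ergodic theorem for a bounded cocycle whose blocks are independent. -/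
theorem exists_tendsto_of_indepFun (h : IsBoundedSubadditive T g C) (hg : ∀ n, Measurable (g n))
    (hT : MeasurePreserving T μ μ)
    (hind : ∀ m : ℕ, Pairwise fun i j : ℕ =>
      IndepFun (fun ω => g m (T^[i * m] ω)) (fun ω => g m (T^[j * m] ω)) μ) :
    ∃ γ : ℝ, 0 ≤ γ ∧ ∀ᵐ ω ∂μ, Tendsto (fun n : ℕ => g n ω / n) atTop (𝓝 γ) := by
  set γ := (h.subadditive_integral hg hT).lim with hγ
  have htend := (h.subadditive_integral hg hT).tendsto_lim h.bddBelow_integral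
  have hγ0 : 0 ≤ γ := ge_of_tendsto' htend fun n =>
    _root_.div_nonneg (integral_nonneg (h.nonneg n)) n.cast_nonneg
  refine ⟨γ, hγ0, ?_⟩
  have hup : ∀ᵐ ω ∂μ, limsup (fun n : ℕ => g n ω / n) atTop ≤ γ := by
    have : ∀ᵐ ω ∂μ, ∀ m : ℕ, 1 ≤ m →
        limsup (fun n : ℕ => g n ω / n) atTop ≤ (∫ ω, g m ω ∂μ) / m := by
      rw [ae_all_iff]
      intro m
      rcases Nat.eq_zero_or_pos m with rfl | hm
      · simp
      · exact (h.limsup_le_of_indepFun hg hT hm (hind m)).mono fun ω hω _ => hω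
    filter_upwards [this] with ω hω
    exact ge_of_tendsto htend ((eventually_ge_atTop 1).mono hω)
  have hle : ∀ᵐ ω ∂μ, lowerRate g ω ≤ γ := hup.mono fun ω hω =>
    (liminf_le_limsup (h.isBoundedUnder_le ω) (h.isBoundedUnder_ge ω)).trans hω
  -- The a.e. nonnegative function γ - `lowerRate g` has integral at most 0, so it vanishes a.e.
  -- This makes the lower rate constant without using ergodicity of T.
  have heq : ∀ᵐ ω ∂μ, γ - lowerRate g ω = 0 := by
    have hi : Integrable (fun ω => γ - lowerRate g ω) μ := (integrable_const γ).sub (h.integrable_lowerRate hg (μ := μ))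
    refine (integral_eq_zero_iff_of_nonneg_ae (hle.mono fun ω hω => ?_) hi).1 ?_
    · simpa using hω
    · refine le_antisymm ?_ (integral_nonneg_of_ae (hle.mono fun ω hω => ?_))
      · rw [integral_sub (integrable_const γ) (h.integrable_lowerRate hg)]
        simpa using h.lim_le_integral_lowerRate hg hT
      · simpa using hω
  filter_upwards [hup, heq] with ω h1 h2
  exact tendsto_of_le_liminf_of_limsup_le (sub_eq_zero.1 h2).le h1
    (h.isBoundedUnder_le ω) (h.isBoundedUnder_ge ω)

end IsBoundedSubadditive

end Anderson

end

noncomputable section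

namespace Anderson

open ProbabilityTheory

/-! ### The operator norm of `2 × 2` matrices -/

lemma opNorm_nonneg (M : Matrix (Fin 2) (Fin 2) ℝ) : 0 ≤ opNorm M := norm_nonneg _

lemma opNorm_mul_le (M N : Matrix (Fin 2) (Fin 2) ℝ) : opNorm (M * N) ≤ opNorm M * opNorm N := by
  unfold opNorm
  rw [map_mul]
  exact norm_mul_le _ _

lemma opNorm_one : opNorm 1 = 1 := by
  unfold opNorm
  rw [map_one]
  exact norm_one

lemma opNorm_transpose (M : Matrix (Fin 2) (Fin 2) ℝ) : opNorm M.transpose = opNorm M := by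
  unfold opNorm
  rw [← Matrix.conjTranspose_eq_transpose_of_trivial, ← Matrix.star_eq_conjTranspose, map_star,
    ContinuousLinearMap.star_eq_adjoint]
  exact LinearIsometryEquiv.norm_map _ _

/-- The matrix J is orthogonal, so the C⋆-identity gives ‖J‖² = ‖JᵀJ‖ = 1. -/
lemma opNorm_rotation_le : opNorm !![0, 1; -1, 0] ≤ 1 := by
  have h1 : opNorm (!![0, 1; -1, 0] : Matrix (Fin 2) (Fin 2) ℝ) ^ 2 = 1 := by
    have h2 : opNorm ((!![0, 1; -1, 0] : Matrix (Fin 2) (Fin 2) ℝ).transpose * !![0, 1; -1, 0]) =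
        opNorm !![0, 1; -1, 0] ^ 2 := by
      unfold opNorm
      rw [← Matrix.conjTranspose_eq_transpose_of_trivial, ← Matrix.star_eq_conjTranspose, map_mul,
        map_star, ContinuousLinearMap.star_eq_adjoint, sq]
      exact ContinuousLinearMap.norm_adjoint_comp_self _
    have h3 : (!![0, 1; -1, 0] : Matrix (Fin 2) (Fin 2) ℝ).transpose * !![0, 1; -1, 0] = 1 := by
      ext i j
      fin_cases i <;> fin_cases j <;> simp [Matrix.mul_apply, Fin.sum_univ_two]
    rw [← h2, h3, opNorm_one]
  nlinarith [opNorm_nonneg (!![0, 1; -1, 0] : Matrix (Fin 2) (Fin 2) ℝ)]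

/-- In dimension two adj M = J Mᵀ Jᵀ with J the quarter turn, and neither transposition nor J
increases the norm. For determinant one this controls the inverse. -/
lemma opNorm_adjugate_le (M : Matrix (Fin 2) (Fin 2) ℝ) : opNorm M.adjugate ≤ opNorm M := by
  have h : M.adjugate = !![0, 1; -1, 0] * M.transpose *
      (!![0, 1; -1, 0] : Matrix (Fin 2) (Fin 2) ℝ).transpose := by
    rw [Matrix.adjugate_fin_two]
    ext i j
    fin_cases i <;> fin_cases j <;>
      simp [Matrix.mul_apply, Fin.sum_univ_two, Matrix.vecMul, dotProduct]
  have h1 := opNorm_rotation_le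
  have h0 := opNorm_nonneg (!![0, 1; -1, 0] : Matrix (Fin 2) (Fin 2) ℝ)
  have hM := opNorm_nonneg M
  calc opNorm M.adjugate ≤ opNorm !![0, 1; -1, 0] * opNorm M * opNorm !![0, 1; -1, 0] := by
        rw [h]
        refine (opNorm_mul_le _ _).trans ?_
        rw [opNorm_transpose]
        gcongr
        exact (opNorm_mul_le _ _).trans_eq (by rw [opNorm_transpose])
    _ ≤ 1 * opNorm M * 1 := by gcongr
    _ = opNorm M := by ring

lemma one_le_opNorm {M : Matrix (Fin 2) (Fin 2) ℝ} (hM : M.det = 1) : 1 ≤ opNorm M := by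
  have h1 : opNorm (M * M.adjugate) = 1 := by
    rw [Matrix.mul_adjugate, hM, one_smul, opNorm_one]
  have h2 := opNorm_mul_le M M.adjugate
  have h3 := opNorm_adjugate_le M
  have h4 := opNorm_nonneg M
  have h5 := opNorm_nonneg M.adjugate
  nlinarith

/-- A bound for the operator norm in terms of `N * M` and a factor `M` of determinant one. -/
lemma opNorm_le_of_mul {M : Matrix (Fin 2) (Fin 2) ℝ} (hM : M.det = 1)
    (N : Matrix (Fin 2) (Fin 2) ℝ) : opNorm N ≤ opNorm (N * M) * opNorm M := by
  have h1 : N = N * M * M.adjugate := by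
    rw [mul_assoc, Matrix.mul_adjugate, hM, one_smul, mul_one]
  calc opNorm N = opNorm (N * M * M.adjugate) := by rw [← h1]
    _ ≤ opNorm (N * M) * opNorm M.adjugate := opNorm_mul_le _ _
    _ ≤ _ := mul_le_mul_of_nonneg_left (opNorm_adjugate_le M) (opNorm_nonneg _)

lemma opNorm_le_of_mul_left {M : Matrix (Fin 2) (Fin 2) ℝ} (hM : M.det = 1)
    (N : Matrix (Fin 2) (Fin 2) ℝ) : opNorm N ≤ opNorm M * opNorm (M * N) := by
  have h1 : N = M.adjugate * (M * N) := by
    rw [← mul_assoc, Matrix.adjugate_mul, hM, one_smul, one_mul]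
  calc opNorm N = opNorm (M.adjugate * (M * N)) := by rw [← h1]
    _ ≤ opNorm M.adjugate * opNorm (M * N) := opNorm_mul_le _ _
    _ ≤ _ := mul_le_mul_of_nonneg_right (opNorm_adjugate_le M) (opNorm_nonneg _)

lemma continuous_opNorm : Continuous opNorm := by
  unfold opNorm
  refine continuous_norm.comp ?_
  exact LinearMap.continuous_of_finiteDimensional
    ((Matrix.toEuclideanCLM (n := Fin 2) (𝕜 := ℝ)).toAlgEquiv.toLinearMap)

/-! ### Products of independent matrices -/

section Cocycle

variable {S : Type*}

/-- The shift on two-sided sequences. -/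
def shift (ω : ℤ → S) : ℤ → S := fun i => ω (i + 1)

lemma iterate_shift_apply (m : ℕ) (ω : ℤ → S) (i : ℤ) : shift^[m] ω i = ω (i + m) := by
  induction m generalizing ω with
  | zero => simp
  | succ m ih =>
    rw [Function.iterate_succ_apply, ih, shift]
    push_cast
    ring_nf

/-- The product `A (ω (n - 1)) * ⋯ * A (ω 0)`. -/
def cocycle (A : S → Matrix (Fin 2) (Fin 2) ℝ) (ω : ℤ → S) : ℕ → Matrix (Fin 2) (Fin 2) ℝ
  | 0 => 1
  | n + 1 => A (ω n) * cocycle A ω n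

variable {A : S → Matrix (Fin 2) (Fin 2) ℝ}

lemma cocycle_add (ω : ℤ → S) (m n : ℕ) :
    cocycle A ω (m + n) = cocycle A (shift^[m] ω) n * cocycle A ω m := by
  induction n with
  | zero => simp [cocycle]
  | succ n ih =>
    rw [← add_assoc, cocycle, ih, cocycle, iterate_shift_apply, mul_assoc]
    push_cast
    rw [add_comm (m : ℤ)]

lemma cocycle_congr {ω ω' : ℤ → S} {n : ℕ} (h : ∀ i : ℕ, i < n → ω i = ω' i) :
    cocycle A ω n = cocycle A ω' n := by
  induction n with
  | zero => rfl
  | succ n ih =>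
    rw [cocycle, cocycle, h n n.lt_succ_self, ih fun i hi => h i (hi.trans n.lt_succ_self)]

lemma det_cocycle (hA : ∀ s, (A s).det = 1) (ω : ℤ → S) (n : ℕ) : (cocycle A ω n).det = 1 := by
  induction n with
  | zero => simp [cocycle]
  | succ n ih => rw [cocycle, Matrix.det_mul, hA, ih, one_mul]

/-- The logarithm of the norm of a product of unimodular matrices. -/
def logNorm (A : S → Matrix (Fin 2) (Fin 2) ℝ) (n : ℕ) (ω : ℤ → S) : ℝ :=
  Real.log (opNorm (cocycle A ω n))

/-- Submultiplicativity of the norm gives subadditivity. Determinant one gives nonnegativity and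
lets the first factor be cancelled at the cost of a factor K, which is `comp_le`. -/
lemma isBoundedSubadditive_logNorm (hA : ∀ s, (A s).det = 1) {K : ℝ} (hK : ∀ s, opNorm (A s) ≤ K) :
    IsBoundedSubadditive shift (logNorm A) (Real.log K) := by
  have hpos : ∀ ω n, 0 < opNorm (cocycle A ω n) := fun ω n =>
    one_pos.trans_le (one_le_opNorm (det_cocycle hA ω n))
  have hposA : ∀ s, 0 < opNorm (A s) := fun s => one_pos.trans_le (one_le_opNorm (hA s))
  refine ⟨fun ω => ?_, fun n ω => Real.log_nonneg (one_le_opNorm (det_cocycle hA ω n)),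
    fun m n ω => ?_, fun ω => ?_, fun n ω => ?_⟩
  · simp [logNorm, cocycle, opNorm_one]
  · unfold logNorm
    rw [← Real.log_mul (hpos _ _).ne' (hpos _ _).ne', cocycle_add, mul_comm]
    refine Real.log_le_log ?_ (opNorm_mul_le _ _)
    rw [← cocycle_add]
    exact hpos _ _
  · simp only [logNorm, cocycle, mul_one]
    exact Real.log_le_log (hposA _) (hK _)
  · unfold logNorm
    have h1 : cocycle A ω (n + 1) = cocycle A (shift ω) n * A (ω 0) := by
      rw [add_comm, cocycle_add]
      simp [cocycle]
    have h2 := opNorm_le_of_mul (hA (ω 0)) (cocycle A (shift ω) n)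
    rw [← h1] at h2
    rw [← Real.log_mul (hpos _ _).ne' ((hposA (ω 0)).trans_le (hK _)).ne']
    exact Real.log_le_log (hpos _ _) (h2.trans (mul_le_mul_of_nonneg_left (hK _) (hpos _ _).le))

variable [MeasurableSpace S]

lemma measurable_cocycle (hA : ∀ i j, Measurable fun s => A s i j) (n : ℕ) (i j : Fin 2) :
    Measurable fun ω => cocycle A ω n i j := by
  induction n generalizing i j with
  | zero => exact measurable_const
  | succ n ih =>
    simp only [cocycle, Matrix.mul_apply]
    exact Finset.measurable_fun_sum _ fun k _ =>
      ((hA i k).comp (measurable_pi_apply _)).mul (ih k j)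

lemma measurable_logNorm (hA : ∀ i j, Measurable fun s => A s i j) (n : ℕ) :
    Measurable (logNorm A n) := by
  have hc : Continuous fun M : Fin 2 → Fin 2 → ℝ => opNorm (Matrix.of M) :=
    continuous_opNorm.comp continuous_id
  have h1 := hc.measurable
  have h2 : Measurable fun ω => (fun i j => cocycle A ω n i j : Fin 2 → Fin 2 → ℝ) :=
    measurable_pi_lambda _ fun i => measurable_pi_lambda _ fun j => measurable_cocycle hA n i j
  exact Real.measurable_log.comp (h1.comp h2)

variable (σ : Measure S) [IsProbabilityMeasure σ]

lemma measurePreserving_shift :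
    MeasurePreserving (shift (S := S)) (Measure.infinitePi fun _ : ℤ => σ)
      (Measure.infinitePi fun _ : ℤ => σ) where
  measurable := measurable_pi_lambda _ fun _ => measurable_pi_apply _
  map_eq := Measure.map_infinitePi_infinitePi_of_inj (P := fun _ : ℤ => σ) (add_left_injective (1 : ℤ))

/-- The i-th block reads only the coordinates in [i m, i m + m), and these windows are disjoint for
distinct i. -/
lemma indepFun_logNorm (hA : ∀ i j, Measurable fun s => A s i j) (m : ℕ) :
    Pairwise fun i j : ℕ => IndepFun (fun ω => logNorm A m (shift^[i * m] ω))
      (fun ω => logNorm A m (shift^[j * m] ω)) (Measure.infinitePi fun _ : ℤ => σ) := by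
  classical
  intro i j hij
  have hne : Nonempty S := nonempty_of_isProbabilityMeasure σ
  have hX : iIndepFun (fun (k : ℤ) (ω : ℤ → S) => ω k) (Measure.infinitePi fun _ : ℤ => σ) :=
    iIndepFun_infinitePi (P := fun _ => σ) (X := fun _ s => s) fun _ => measurable_id
  let I : ℕ → Finset ℤ := fun i => Finset.Ico (i * m : ℤ) (i * m + m)
  have hdisj : Disjoint (I i) (I j) := by
    rw [Finset.disjoint_left]
    intro k hk hk'
    simp only [I, Finset.mem_Ico] at hk hk'
    rcases lt_or_gt_of_ne hij with h | h
    · have : ((i : ℤ) + 1) * m ≤ j * m := by gcongr; exact_mod_cast h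
      linarith
    · have : ((j : ℤ) + 1) * m ≤ i * m := by gcongr; exact_mod_cast h
      linarith
  -- Extends a finite window to a full sequence; the filler value is immaterial by `cocycle_congr`.
  let e : (i : ℕ) → (I i → S) → ℤ → S := fun i x k =>
    if h : k ∈ I i then x ⟨k, h⟩ else Classical.arbitrary S
  have he : ∀ i, Measurable (e i) := fun i => measurable_pi_lambda _ fun k => by
    by_cases h : k ∈ I i
    · simp only [e, h, dite_true]
      exact measurable_pi_apply _
    · simp only [e, h, dite_false]
      exact measurable_const
  have hfac : ∀ i : ℕ, (fun ω => logNorm A m (shift^[i * m] ω)) =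
      (fun x => logNorm A m (shift^[i * m] (e i x))) ∘ fun (ω : ℤ → S) (k : I i) => ω k := by
    intro i
    funext ω
    simp only [Function.comp, logNorm]
    congr 2
    refine cocycle_congr fun k hk => ?_
    rw [iterate_shift_apply, iterate_shift_apply]
    have : (k : ℤ) + ((i * m : ℕ) : ℤ) ∈ I i := by
      simp only [I, Finset.mem_Ico]
      push_cast
      omega
    simp only [e, this, dite_true]
  have hmeas : ∀ i, Measurable fun x => logNorm A m (shift^[i * m] (e i x)) := fun i =>
    (measurable_logNorm hA m).comp
      (((measurePreserving_shift σ).iterate _).measurable.comp (he i))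
  rw [hfac i, hfac j]
  exact (hX.indepFun_finset (I i) (I j) hdisj fun k => measurable_pi_apply k).comp
    (hmeas i) (hmeas j)

/-- The Furstenberg–Kesten theorem for bounded independent unimodular matrices. -/
theorem exists_tendsto_logNorm (hm : ∀ i j, Measurable fun s => A s i j)
    (hdet : ∀ s, (A s).det = 1) {K : ℝ} (hK : ∀ s, opNorm (A s) ≤ K) :
    ∃ γ : ℝ, 0 ≤ γ ∧ ∀ᵐ ω ∂(Measure.infinitePi fun _ : ℤ => σ),
      Tendsto (fun n : ℕ => Real.log (opNorm (cocycle A ω n)) / n) atTop (𝓝 γ) :=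
  (isBoundedSubadditive_logNorm hdet hK).exists_tendsto_of_indepFun (measurable_logNorm hm)
    (measurePreserving_shift σ) (indepFun_logNorm σ hm)

end Cocycle

/-! ### The discrete case -/

namespace Discrete

/-- The one-step transfer matrix. -/
def stepMatrix (E s : ℝ) : Matrix (Fin 2) (Fin 2) ℝ := !![E - s, -1; 1, 0]

lemma det_stepMatrix (E s : ℝ) : (stepMatrix E s).det = 1 := by
  simp [stepMatrix, Matrix.det_fin_two]

lemma continuous_stepMatrix (E : ℝ) : Continuous (stepMatrix E) := by
  refine continuous_matrix fun i j => ?_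
  fin_cases i <;> fin_cases j <;> simp [stepMatrix] <;> fun_prop

lemma IsSolution.succ {V : ℤ → ℝ} {E : ℝ} {u : ℤ → ℝ} (hu : IsSolution V E u) (n : ℤ) :
    ![u (n + 1), u n] = (stepMatrix E (V n)).mulVec ![u n, u (n - 1)] := by
  have := hu n
  funext i
  fin_cases i <;> simp [stepMatrix, Matrix.mulVec, dotProduct, Fin.sum_univ_two]
  linarith

lemma exists_isSolution (V : ℤ → ℝ) (E a b : ℝ) :
    ∃ u, IsSolution V E u ∧ u 1 = a ∧ u 0 = b := by
  -- The recursion is run in both directions from the data at 0 and 1: p n = (u (n + 1), u n) and q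
  -- n = (u (1 - n), u (-n)).
  let p : ℕ → ℝ × ℝ := fun n => Nat.rec (a, b)
    (fun n q => ((E - V (n + 1)) * q.1 - q.2, q.1)) n
  let q : ℕ → ℝ × ℝ := fun n => Nat.rec (a, b)
    (fun n q => (q.2, (E - V (-n)) * q.2 - q.1)) n
  let u : ℤ → ℝ := fun n => match n with
    | Int.ofNat n => (p n).2
    | Int.negSucc n => (q (n + 1)).2
  have hp : ∀ n : ℕ, u n = (p n).2 := fun n => rfl
  have hp1 : ∀ n : ℕ, u (n + 1) = (p n).1 := fun n => rfl
  have hq : ∀ n : ℕ, u (-n) = (q n).2 := fun n => by cases n <;> rfl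
  have hq1 : ∀ n : ℕ, u (1 - n) = (q n).1 := fun n => by
    cases n with
    | zero => rfl
    | succ n =>
      rw [show (1 - ((n + 1 : ℕ) : ℤ)) = -(n : ℤ) by push_cast; ring, hq]
  refine ⟨u, fun n => ?_, rfl, rfl⟩
  rcases le_or_gt n 0 with hn | hn
  · obtain ⟨k, rfl⟩ : ∃ k : ℕ, n = -k := ⟨(-n).toNat, by omega⟩
    have h1 : u (-(k : ℤ) - 1) = (q (k + 1)).2 := by
      rw [← hq (k + 1)]; push_cast; ring_nf
    have h2 : u (-(k : ℤ) + 1) = (q k).1 := by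
      rw [← hq1]; ring_nf
    rw [h1, h2, hq]
    simp only [q]
    ring
  · obtain ⟨k, rfl⟩ : ∃ k : ℕ, n = k + 1 := ⟨(n - 1).toNat, by omega⟩
    have h1 : u ((k : ℤ) + 1 + 1) = (p (k + 1)).1 := by
      rw [← hp1 (k + 1)]; push_cast; rfl
    have h2 : u ((k : ℤ) + 1 - 1) = (p k).2 := by
      rw [← hp]; ring_nf
    rw [h1, h2, hp1]
    simp only [p]
    ring

lemma exists_isTransferMatrix (V : ℤ → ℝ) (E : ℝ) (n : ℤ) : ∃ M, IsTransferMatrix V E n M := by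
  induction n with
  | zero => exact ⟨1, fun u _ => by simp⟩
  | succ n ih =>
    obtain ⟨M, hM⟩ := ih
    refine ⟨stepMatrix E (V (n + 1)) * M, fun u hu => ?_⟩
    rw [hu.succ, ← Matrix.mulVec_mulVec, ← hM u hu, add_sub_cancel_right]
  | pred n ih =>
    obtain ⟨M, hM⟩ := ih
    refine ⟨(stepMatrix E (V (-n))).adjugate * M, fun u hu => ?_⟩
    rw [← Matrix.mulVec_mulVec, ← hM u hu, hu.succ (-n), Matrix.mulVec_mulVec, Matrix.adjugate_mul,
      det_stepMatrix, one_smul, Matrix.one_mulVec, sub_add_cancel]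

end Discrete

lemma matrix_ext_of_mulVec {M N : Matrix (Fin 2) (Fin 2) ℝ}
    (h : ∀ a b : ℝ, M.mulVec ![a, b] = N.mulVec ![a, b]) : M = N := by
  ext i j
  have h1 := congrFun (h 1 0) i
  have h2 := congrFun (h 0 1) i
  simp only [Matrix.mulVec, dotProduct, Fin.sum_univ_two, Matrix.cons_val_zero,
    Matrix.cons_val_one, mul_one, mul_zero, add_zero, zero_add] at h1 h2
  fin_cases j <;> assumption

namespace Discrete

lemma existsUnique_isTransferMatrix (V : ℤ → ℝ) (E : ℝ) (n : ℤ) :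
    ∃! M, IsTransferMatrix V E n M := by
  obtain ⟨M, hM⟩ := exists_isTransferMatrix V E n
  refine ⟨M, hM, fun N hN => matrix_ext_of_mulVec fun a b => ?_⟩
  obtain ⟨u, hu, rfl, rfl⟩ := exists_isSolution V E a b
  rw [← hM u hu, ← hN u hu]

lemma isTransferMatrix_transferMatrix (V : ℤ → ℝ) (E : ℝ) (n : ℤ) :
    IsTransferMatrix V E n (transferMatrix V E n) :=
  Classical.epsilon_spec (exists_isTransferMatrix V E n)

/-- The data sit at the sites 1 and 0, so the first factor involves ω 1 rather than ω 0; hence the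
shift. -/
lemma transferMatrix_eq_cocycle {ν : Measure ℝ} (ω : Omega ν) (E : ℝ) (n : ℕ) :
    transferMatrix (potential ω) E n = cocycle (fun s : ν.support => stepMatrix E s) (shift ω) n := by
  refine (existsUnique_isTransferMatrix _ E n).unique
    (isTransferMatrix_transferMatrix _ E n) fun u hu => ?_
  induction n with
  | zero => simp [cocycle]
  | succ n ih =>
    rw [cocycle, ← Matrix.mulVec_mulVec, ← ih, hu.succ]
    push_cast
    rw [add_sub_cancel_right]
    rfl

end Discrete

lemma exists_opNorm_le {ν : Measure ℝ} (hν : IsCompact ν.support)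
    {A : ℝ → Matrix (Fin 2) (Fin 2) ℝ} (hA : Continuous A) :
    ∃ K, ∀ s : ν.support, opNorm (A s) ≤ K := by
  obtain ⟨K, hK⟩ := hν.exists_bound_of_continuousOn (continuous_opNorm.comp hA).continuousOn
  exact ⟨K, fun s => (le_abs_self _).trans (hK s s.2)⟩

lemma measurable_entry {ν : Measure ℝ} {A : ℝ → Matrix (Fin 2) (Fin 2) ℝ} (hA : Continuous A)
    (i j : Fin 2) : Measurable fun s : ν.support => A s i j :=
  ((hA.matrix_elem i j).comp continuous_subtype_val).measurable

/-- The discrete case of the main theorem. -/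
theorem discrete_lyapunov (ν : Measure ℝ) [IsProbabilityMeasure ν] (hν : IsCompact ν.support)
    (E : ℝ) : ∃ γ : ℝ, 0 ≤ γ ∧ ∀ᵐ ω ∂(mu ν),
      Tendsto (Discrete.growthRate (Discrete.potential ω) E) atTop (𝓝 γ) := by
  have hc := Discrete.continuous_stepMatrix E
  obtain ⟨K, hK⟩ := exists_opNorm_le hν hc
  obtain ⟨γ, hγ, h⟩ := exists_tendsto_logNorm (siteMeasure ν) (measurable_entry hc)
    (fun s => Discrete.det_stepMatrix E s) hK
  refine ⟨γ, hγ, ?_⟩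
  -- The limit is known for almost every sequence and is needed at its shift; invariance of the
  -- product measure transfers it.
  filter_upwards [(measurePreserving_shift (siteMeasure ν)).quasiMeasurePreserving.ae h] with ω hω
  refine hω.congr fun n => ?_
  rw [Discrete.growthRate, Discrete.transferMatrix_eq_cocycle, one_div_mul_eq_div]

end Anderson

end

noncomputable section

namespace Anderson

/-! ### Linear Volterra equations with locally integrable coefficients -/

/-- Integrability on every compact interval. -/
abbrev LocInt (f : ℝ → ℝ) : Prop := ∀ a b : ℝ, IntervalIntegrable f volume a b

lemma LocInt.mul_continuous {f g : ℝ → ℝ} (hf : LocInt f) (hg : Continuous g) :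
    LocInt fun t => f t * g t :=
  fun a b => (hf a b).mul_continuousOn hg.continuousOn

lemma LocInt.of_continuous {f : ℝ → ℝ} (hf : Continuous f) : LocInt f :=
  fun a b => hf.intervalIntegrable a b

lemma LocInt.continuous_primitive {f : ℝ → ℝ} (hf : LocInt f) (a : ℝ) :
    Continuous fun x => ∫ t in a..x, f t :=
  intervalIntegral.continuous_primitive hf a

/-- Absolute continuity is taken on the interval spanned by a, b and c, which contains the base
point, and then restricted. -/
lemma LocInt.absolutelyContinuous {f : ℝ → ℝ} (hf : LocInt f) (c a b : ℝ) :
    AbsolutelyContinuousOnInterval (fun x => ∫ t in c..x, f t) a b := by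
  have hle : ∀ y, min a (min b c) ≤ y → y ≤ max a (max b c) →
      y ∈ uIcc (min a (min b c)) (max a (max b c)) := fun y h1 h2 => mem_uIcc.2 (Or.inl ⟨h1, h2⟩)
  refine ((hf _ _).absolutelyContinuousOnInterval_intervalIntegral
    (hle c (by simp) (by simp))).mono (uIcc_subset_uIcc (hle a ?_ ?_) (hle b ?_ ?_)) <;> simp

lemma LocInt.ae_hasDerivAt_primitive {f : ℝ → ℝ} (hf : LocInt f) (c : ℝ) :
    ∀ᵐ x, HasDerivAt (fun x => ∫ t in c..x, f t) (f x) x := by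
  have h : LocallyIntegrable f volume := by
    intro x
    refine ⟨Ioo (x - 1) (x + 1), Ioo_mem_nhds (by linarith) (by linarith), ?_⟩
    exact ((intervalIntegrable_iff_integrableOn_Ioo_of_le (by linarith)).1 (hf _ _))
  exact (LocallyIntegrable.ae_hasDerivAt_integral h).mono fun x hx => hx c

/-- On the interval f takes values in some [-C, C], where exp is Lipschitz with constant exp C. -/
lemma absolutelyContinuous_exp {f : ℝ → ℝ} {a b : ℝ} (hf : AbsolutelyContinuousOnInterval f a b) :
    AbsolutelyContinuousOnInterval (fun x => Real.exp (f x)) a b := by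
  obtain ⟨C, hC⟩ := hf.exists_bound
  have hlip : ∀ x ∈ uIcc a b, ∀ y ∈ uIcc a b,
      dist (Real.exp (f x)) (Real.exp (f y)) ≤ Real.exp C * dist (f x) (f y) := by
    intro x hx y hy
    have := (convex_Icc (-C) C).norm_image_sub_le_of_norm_deriv_le (f := Real.exp) (𝕜 := ℝ)
      (C := Real.exp C) (x := f y) (y := f x) (fun z _ => Real.differentiableAt_exp)
      (fun z hz => by
        rw [Real.deriv_exp, Real.norm_of_nonneg (Real.exp_nonneg _)]
        exact Real.exp_le_exp.2 hz.2) (abs_le.1 (hC y hy)) (abs_le.1 (hC x hx))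
    simpa [dist_eq_norm] using this
  unfold AbsolutelyContinuousOnInterval at hf ⊢
  refine squeeze_zero' (Eventually.of_forall fun E => Finset.sum_nonneg fun i _ => dist_nonneg) ?_
    (by simpa using hf.const_mul (Real.exp C))
  rw [eventually_inf_principal]
  filter_upwards with E hE
  rw [Finset.mul_sum]
  exact Finset.sum_le_sum fun i hi => hlip _ (hE.1 i hi).1 _ (hE.1 i hi).2

/-- The exponential of the primitive is absolutely continuous, so its a.e. derivative integrates
back to it. The parameter θ takes the values 2 and -2, for the two sides of the origin. -/
lemma integral_mul_exp_primitive {k : ℝ → ℝ} (hk : LocInt k) (θ x : ℝ) :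
    θ * ∫ t in 0..x, k t * Real.exp (θ * ∫ s in 0..t, k s) =
      Real.exp (θ * ∫ s in 0..x, k s) - 1 := by
  have hac : AbsolutelyContinuousOnInterval (fun x => Real.exp (θ * ∫ s in 0..x, k s)) 0 x :=
    absolutelyContinuous_exp ((hk.absolutelyContinuous 0 0 x).const_mul θ)
  have h := hac.integral_deriv_eq_sub
  simp only [intervalIntegral.integral_same, mul_zero, Real.exp_zero] at h
  rw [← h, ← intervalIntegral.integral_const_mul]
  refine intervalIntegral.integral_congr_ae ?_
  filter_upwards [hk.ae_hasDerivAt_primitive 0] with t ht _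
  rw [((ht.const_mul θ).exp).deriv]
  ring

/-! ### Exponentially weighted estimates for Volterra integrals. -/

/-- The weight `exp (2 |∫₀ˣ k|)`. -/
def expWeight (k : ℝ → ℝ) (x : ℝ) : ℝ := Real.exp (2 * |∫ t in 0..x, k t|)

lemma one_le_expWeight (k : ℝ → ℝ) (x : ℝ) : 1 ≤ expWeight k x :=
  Real.one_le_exp (by positivity)

lemma expWeight_pos (k : ℝ → ℝ) (x : ℝ) : 0 < expWeight k x := Real.exp_pos _

lemma continuous_expWeight {k : ℝ → ℝ} (hk : LocInt k) : Continuous (expWeight k) :=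
  Real.continuous_exp.comp (continuous_const.mul (hk.continuous_primitive 0).abs)

lemma abs_integral_mul_expWeight {k : ℝ → ℝ} (hk : LocInt k) (hk0 : ∀ t, 0 ≤ k t) (x : ℝ) :
    |∫ t in 0..x, k t * expWeight k t| = (expWeight k x - 1) / 2 := by
  rcases le_total 0 x with hx | hx
  · have h1 : ∫ t in 0..x, k t * expWeight k t =
        ∫ t in 0..x, k t * Real.exp (2 * ∫ s in 0..t, k s) := by
      refine intervalIntegral.integral_congr fun t ht => ?_
      rw [uIcc_of_le hx] at ht
      simp only [expWeight]
      rw [abs_of_nonneg (intervalIntegral.integral_nonneg ht.1 fun s _ => hk0 s)]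
    have h2 := integral_mul_exp_primitive hk 2 x
    rw [abs_of_nonneg (intervalIntegral.integral_nonneg hx fun t _ =>
      mul_nonneg (hk0 t) (expWeight_pos k t).le), h1, expWeight,
      abs_of_nonneg (intervalIntegral.integral_nonneg hx fun s _ => hk0 s)]
    linarith
  · have hneg : ∀ t ≤ 0, |∫ s in 0..t, k s| = -∫ s in 0..t, k s := fun t ht => by
      rw [abs_of_nonpos]
      rw [intervalIntegral.integral_symm]
      exact neg_nonpos.2 (intervalIntegral.integral_nonneg ht fun s _ => hk0 s)
    have h1 : ∫ t in 0..x, k t * expWeight k t =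
        ∫ t in 0..x, k t * Real.exp ((-2) * ∫ s in 0..t, k s) := by
      refine intervalIntegral.integral_congr fun t ht => ?_
      rw [uIcc_of_ge hx] at ht
      simp only [expWeight]
      rw [hneg t ht.2]
      ring_nf
    have h2 := integral_mul_exp_primitive hk (-2) x
    rw [← h1] at h2
    have h3 : expWeight k x = Real.exp ((-2) * ∫ s in 0..x, k s) := by
      rw [expWeight, hneg x hx]; ring_nf
    rw [← h3] at h2
    rw [abs_of_nonpos (by linarith [one_le_expWeight k x])]
    linarith

/-- The exponent 2 in the weight makes the Volterra operator with kernel k halve the weighted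
supremum norm, on intervals of any length. -/
lemma abs_integral_le_expWeight {k f : ℝ → ℝ} (hk : LocInt k) (hk0 : ∀ t, 0 ≤ k t) {c x : ℝ}
    (hc : 0 ≤ c) (hf : ∀ t ∈ uIoc 0 x, |f t| ≤ k t * (c * expWeight k t)) :
    |∫ t in 0..x, f t| ≤ c * ((expWeight k x - 1) / 2) := by
  rw [← abs_integral_mul_expWeight hk hk0, ← abs_of_nonneg hc, ← abs_mul,
    ← intervalIntegral.integral_const_mul, ← Real.norm_eq_abs]
  refine intervalIntegral.norm_integral_le_abs_of_norm_le ?_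
    ((hk.mul_continuous (continuous_expWeight hk)) 0 x |>.const_mul c)
  refine (ae_restrict_mem measurableSet_uIoc).mono fun t ht => ?_
  exact (hf t ht).trans_eq (by ring)

/-- A Grönwall inequality with an integrable rate. -/
theorem le_expWeight_of_le_integral {k z : ℝ → ℝ} (hk : LocInt k) (hk0 : ∀ t, 0 ≤ k t)
    (hz : Continuous z) (hz0 : ∀ t, 0 ≤ z t) {c X : ℝ}
    (h : ∀ x ∈ uIcc 0 X, z x ≤ c + |∫ t in 0..x, k t * z t|) : z X ≤ 2 * c * expWeight k X := by
  have hW := continuous_expWeight hk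
  have hWpos := expWeight_pos k
  -- At a maximum point of z / W, with W the weight and M the maximum, the hypothesis reads M W ≤ c
  -- + M (W - 1) / 2, that is M (W + 1) ≤ 2 c.
  obtain ⟨x₀, hx₀, hmax⟩ := isCompact_uIcc.exists_isMaxOn (nonempty_uIcc (a := 0) (b := X))
    ((hz.div hW fun t => (hWpos t).ne').continuousOn)
  set M := z x₀ / expWeight k x₀ with hM
  have hM0 : 0 ≤ M := div_nonneg (hz0 _) (hWpos _).le
  have hle : ∀ x ∈ uIcc 0 X, z x ≤ M * expWeight k x := fun x hx =>
    (div_le_iff₀ (hWpos x)).1 (hmax hx)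
  have h1 : |∫ t in 0..x₀, k t * z t| ≤ M * ((expWeight k x₀ - 1) / 2) := by
    refine abs_integral_le_expWeight hk hk0 hM0 fun t ht => ?_
    rw [abs_of_nonneg (mul_nonneg (hk0 t) (hz0 t))]
    exact mul_le_mul_of_nonneg_left
      (hle t (uIcc_subset_uIcc_left hx₀ (uIoc_subset_uIcc ht))) (hk0 t)
  have h2 := h x₀ hx₀
  have h3 : z x₀ = M * expWeight k x₀ := by rw [hM, div_mul_cancel₀ _ (hWpos _).ne']
  have h4 := one_le_expWeight k x₀
  have h5 : M ≤ 2 * c := by nlinarith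
  exact (hle X right_mem_uIcc).trans (mul_le_mul_of_nonneg_right h5 (hWpos _).le)

lemma continuous_tsum_of_expWeight {k : ℝ → ℝ} (hk : LocInt k) {g : ℕ → ℝ → ℝ} {c : ℝ}
    (hc : 0 ≤ c) (hg : ∀ n, Continuous (g n))
    (hb : ∀ n t, |g n t| ≤ c * (1 / 2) ^ n * expWeight k t) :
    Continuous fun t => ∑' n, g n t := by
  rw [continuous_iff_continuousAt]
  intro x
  obtain ⟨B, hB⟩ := isCompact_Icc.exists_bound_of_continuousOn (s := Icc (x - 1) (x + 1))
    (continuous_expWeight hk).continuousOn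
  refine ContinuousOn.continuousAt (s := Icc (x - 1) (x + 1)) ?_
    (Icc_mem_nhds (by linarith) (by linarith))
  refine continuousOn_tsum (u := fun n => c * (1 / 2) ^ n * B) (fun n => (hg n).continuousOn)
    ((summable_geometric_two.mul_left c).mul_right B) fun n t ht => (hb n t).trans ?_
  exact mul_le_mul_of_nonneg_left ((le_abs_self _).trans (hB t ht)) (by positivity)

lemma summable_of_expWeight {k : ℝ → ℝ} {g : ℕ → ℝ → ℝ} {c : ℝ}
    (hb : ∀ n t, |g n t| ≤ c * (1 / 2) ^ n * expWeight k t) (t : ℝ) :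
    Summable fun n => g n t :=
  Summable.of_norm_bounded ((summable_geometric_two.mul_left c).mul_right (expWeight k t))
    fun n => hb n t

lemma hasSum_integral_of_expWeight {k f : ℝ → ℝ} (hk : LocInt k) (hf : LocInt f)
    (hfk : ∀ t, |f t| ≤ k t) {g : ℕ → ℝ → ℝ} {c : ℝ} (hg : ∀ n, Continuous (g n))
    (hb : ∀ n t, |g n t| ≤ c * (1 / 2) ^ n * expWeight k t) (x : ℝ) :
    HasSum (fun n => ∫ t in 0..x, f t * g n t) (∫ t in 0..x, f t * ∑' n, g n t) := by
  have hs : ∀ t, HasSum (fun n : ℕ => k t * (c * (1 / 2) ^ n * expWeight k t))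
      (k t * (c * 2 * expWeight k t)) := fun t =>
    (((hasSum_geometric_two).mul_left c).mul_right _).mul_left _
  refine intervalIntegral.hasSum_integral_of_dominated_convergence
    (fun n t => k t * (c * (1 / 2) ^ n * expWeight k t)) (fun n => ?_) (fun n => ?_) ?_ ?_ ?_
  · exact (hf.mul_continuous (hg n) 0 x).aestronglyMeasurable_restrict_uIoc
  · refine Eventually.of_forall fun t _ => ?_
    rw [norm_mul]
    exact mul_le_mul (hfk t) (hb n t) (norm_nonneg _) ((abs_nonneg _).trans (hfk t))
  · exact Eventually.of_forall fun t _ => (hs t).summable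
  · simp only [fun t => (hs t).tsum_eq]
    exact hk.mul_continuous (continuous_const.mul (continuous_expWeight hk)) 0 x
  · exact Eventually.of_forall fun t _ => (summable_of_expWeight hb t).hasSum.mul_left _

/-! ### The integral system: existence, a priori bound, uniqueness. -/

/-- The successive approximations for `p' = w u`, `u' = p`. -/
def picardIterate (w : ℝ → ℝ) (a b : ℝ) : ℕ → (ℝ → ℝ) × (ℝ → ℝ)
  | 0 => (fun _ => a, fun _ => b)
  | n + 1 => (fun x => ∫ t in 0..x, w t * (picardIterate w a b n).2 t,
      fun x => ∫ t in 0..x, 1 * (picardIterate w a b n).1 t)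

/-- A rate dominating both coefficients of the system `p' = w u`, `u' = p`. -/
def rate (w : ℝ → ℝ) (t : ℝ) : ℝ := 1 + |w t|

lemma rate_nonneg (w : ℝ → ℝ) (t : ℝ) : 0 ≤ rate w t := by unfold rate; positivity

lemma abs_le_rate (w : ℝ → ℝ) (t : ℝ) : |w t| ≤ rate w t := by unfold rate; linarith

lemma one_le_rate (w : ℝ → ℝ) (t : ℝ) : |(1 : ℝ)| ≤ rate w t := by
  unfold rate; rw [abs_one]; linarith [abs_nonneg (w t)]

lemma LocInt.rate {w : ℝ → ℝ} (hw : LocInt w) : LocInt (rate w) := fun a b =>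
  (intervalIntegrable_const (c := (1 : ℝ))).add (hw a b).abs

lemma continuous_picardIterate {w : ℝ → ℝ} (hw : LocInt w) (a b : ℝ) (n : ℕ) :
    Continuous (picardIterate w a b n).1 ∧ Continuous (picardIterate w a b n).2 := by
  induction n with
  | zero => exact ⟨continuous_const, continuous_const⟩
  | succ n ih =>
    exact ⟨(hw.mul_continuous ih.2).continuous_primitive 0,
      (LocInt.of_continuous (continuous_const.mul ih.1)).continuous_primitive 0⟩

lemma abs_picardIterate_le {w : ℝ → ℝ} (hw : LocInt w) (a b : ℝ) (n : ℕ) (x : ℝ) :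
    |(picardIterate w a b n).1 x| ≤ (|a| + |b|) * (1 / 2) ^ n * expWeight (rate w) x ∧
    |(picardIterate w a b n).2 x| ≤ (|a| + |b|) * (1 / 2) ^ n * expWeight (rate w) x := by
  have hc : 0 ≤ |a| + |b| := by positivity
  -- Both components have the form ∫ f g with |f| ≤ `rate w`: f is w in one and the explicit factor
  -- 1 in the other.
  have hstep : ∀ (n : ℕ) (f g : ℝ → ℝ), (∀ t, |f t| ≤ rate w t) →
      (∀ t, |g t| ≤ (|a| + |b|) * (1 / 2) ^ n * expWeight (rate w) t) → ∀ x,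
      |∫ t in 0..x, f t * g t| ≤ (|a| + |b|) * (1 / 2) ^ (n + 1) * expWeight (rate w) x := by
    intro n f g hf hg x
    refine (abs_integral_le_expWeight hw.rate (rate_nonneg w)
      (c := (|a| + |b|) * (1 / 2) ^ n) (by positivity) fun t _ => ?_).trans ?_
    · rw [abs_mul]
      exact mul_le_mul (hf t) (hg t) (abs_nonneg _) (rate_nonneg w t)
    · rw [pow_succ]
      have : 0 ≤ (|a| + |b|) * (1 / 2) ^ n := by positivity
      nlinarith
  induction n generalizing x with
  | zero =>
    have h1 := one_le_expWeight (rate w) x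
    simp only [picardIterate, pow_zero, mul_one]
    constructor <;> nlinarith [abs_nonneg a, abs_nonneg b]
  | succ n ih =>
    exact ⟨hstep n w _ (abs_le_rate w) (fun t => (ih t).2) x,
      hstep n (fun _ => 1) _ (one_le_rate w) (fun t => (ih t).1) x⟩

/-- Between `0` and `X`, `(p, u)` solves `p' = w u`, `u' = p` in integral form. -/
structure SolvesTo (w : ℝ → ℝ) (X : ℝ) (p u : ℝ → ℝ) : Prop where
  continuous_fst : Continuous p
  continuous_snd : Continuous u
  fst_eq : ∀ x ∈ uIcc 0 X, p x = p 0 + ∫ t in 0..x, w t * u t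
  snd_eq : ∀ x ∈ uIcc 0 X, u x = u 0 + ∫ t in 0..x, p t

/-- The solution is the sum of the iterates. They decay like 2⁻ⁿ in the weighted norm, so sum and
integral may be exchanged, and integrating the series shifts it by one term. -/
theorem exists_solvesTo {w : ℝ → ℝ} (hw : LocInt w) (a b : ℝ) :
    ∃ p u : ℝ → ℝ, (∀ X, SolvesTo w X p u) ∧ p 0 = a ∧ u 0 = b := by
  have hc : 0 ≤ |a| + |b| := by positivity
  have hcont := continuous_picardIterate hw a b
  have hbd := abs_picardIterate_le hw a b
  let p : ℝ → ℝ := fun x => ∑' n, (picardIterate w a b n).1 x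
  let u : ℝ → ℝ := fun x => ∑' n, (picardIterate w a b n).2 x
  have hp : ∀ x, p x = a + ∫ t in 0..x, w t * u t := fun x => by
    have h := hasSum_integral_of_expWeight hw.rate hw (abs_le_rate w) (fun n => (hcont n).2)
      (fun n t => (hbd n t).2) x
    rw [← h.tsum_eq]
    exact (summable_of_expWeight (fun n t => (hbd n t).1) x).tsum_eq_zero_add
  have hu : ∀ x, u x = b + ∫ t in 0..x, p t := fun x => by
    have h := hasSum_integral_of_expWeight (f := fun _ => 1) hw.rate
      (LocInt.of_continuous continuous_const) (one_le_rate w) (fun n => (hcont n).1)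
      (fun n t => (hbd n t).1) x
    have h2 : ∫ t in 0..x, p t = ∫ t in 0..x, 1 * p t := by simp
    rw [h2, ← h.tsum_eq]
    exact (summable_of_expWeight (fun n t => (hbd n t).2) x).tsum_eq_zero_add
  have hp0 : p 0 = a := by simp [hp 0]
  have hu0 : u 0 = b := by simp [hu 0]
  refine ⟨p, u, fun X => ⟨?_, ?_, fun x _ => ?_, fun x _ => ?_⟩, hp0, hu0⟩
  · exact continuous_tsum_of_expWeight hw.rate hc (fun n => (hcont n).1) fun n t => (hbd n t).1
  · exact continuous_tsum_of_expWeight hw.rate hc (fun n => (hcont n).2) fun n t => (hbd n t).2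
  · rw [hp0]; exact hp x
  · rw [hu0]; exact hu x

lemma abs_integral_add_abs_integral_le {w p u : ℝ → ℝ} (hw : LocInt w) (hp : Continuous p)
    (hu : Continuous u) (x : ℝ) :
    |∫ t in 0..x, w t * u t| + |∫ t in 0..x, p t| ≤
      |∫ t in 0..x, rate w t * (|p t| + |u t|)| := by
  have h1 := ((hw.mul_continuous hu) 0 x).def'
  have h2 := (hp.intervalIntegrable (μ := volume) 0 x).def'
  have h3 := ((hw.rate.mul_continuous (hp.abs.add hu.abs)) 0 x).def'
  simp only [intervalIntegral.abs_intervalIntegral_eq]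
  refine (add_le_add (norm_integral_le_integral_norm fun t => w t * u t)
    (norm_integral_le_integral_norm p)).trans (le_trans ?_ (le_abs_self _))
  rw [← integral_add h1.norm h2.norm]
  refine integral_mono (h1.norm.add h2.norm) h3 fun t => ?_
  simp only [rate, norm_mul, Real.norm_eq_abs]
  nlinarith [abs_nonneg (p t), abs_nonneg (u t), abs_nonneg (w t),
    mul_nonneg (abs_nonneg (w t)) (abs_nonneg (p t))]

/-- The basic estimate for the system `p' = w u + f`, `u' = p`. -/
theorem abs_add_abs_le_of_perturbed {w f p u : ℝ → ℝ} (hw : LocInt w) {X c : ℝ}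
    (hp : Continuous p) (hu : Continuous u)
    (hpe : ∀ x ∈ uIcc 0 X, p x = p 0 + (∫ t in 0..x, w t * u t) + f x)
    (hue : ∀ x ∈ uIcc 0 X, u x = u 0 + ∫ t in 0..x, p t)
    (hf : ∀ x ∈ uIcc 0 X, |p 0| + |u 0| + |f x| ≤ c) :
    |p X| + |u X| ≤ 2 * c * expWeight (rate w) X := by
  refine le_expWeight_of_le_integral (z := fun t => |p t| + |u t|) hw.rate (rate_nonneg w)
    (hp.abs.add hu.abs) (fun t => by positivity) fun x hx => ?_
  have h1 := abs_integral_add_abs_integral_le hw hp hu x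
  have h2 := hf x hx
  have h3 := abs_add_le (p 0 + ∫ t in 0..x, w t * u t) (f x)
  have h4 := abs_add_le (p 0) (∫ t in 0..x, w t * u t)
  have h5 := abs_add_le (u 0) (∫ t in 0..x, p t)
  rw [← hpe x hx] at h3
  rw [← hue x hx] at h5
  linarith

lemma SolvesTo.abs_add_abs_le {w p u : ℝ → ℝ} (hw : LocInt w) {X : ℝ} (h : SolvesTo w X p u) :
    |p X| + |u X| ≤ 2 * (|p 0| + |u 0|) * expWeight (rate w) X :=
  abs_add_abs_le_of_perturbed (f := fun _ => 0) hw h.continuous_fst h.continuous_snd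
    (fun x hx => by rw [add_zero]; exact h.fst_eq x hx) h.snd_eq (fun x _ => by simp)

lemma SolvesTo.linear_combination {w p u q v : ℝ → ℝ} (hw : LocInt w) {X : ℝ}
    (h : SolvesTo w X p u) (h' : SolvesTo w X q v) (a b : ℝ) :
    SolvesTo w X (fun x => a * p x + b * q x) (fun x => a * u x + b * v x) where
  continuous_fst := (continuous_const.mul h.continuous_fst).add
    (continuous_const.mul h'.continuous_fst)
  continuous_snd := (continuous_const.mul h.continuous_snd).add
    (continuous_const.mul h'.continuous_snd)
  fst_eq x hx := by
    have h1 : ∫ t in 0..x, w t * (a * u t + b * v t) =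
        a * (∫ t in 0..x, w t * u t) + b * ∫ t in 0..x, w t * v t := by
      rw [← intervalIntegral.integral_const_mul, ← intervalIntegral.integral_const_mul,
        ← intervalIntegral.integral_add ((hw.mul_continuous h.continuous_snd 0 x).const_mul a)
          ((hw.mul_continuous h'.continuous_snd 0 x).const_mul b)]
      congr 1
      funext t
      ring
    rw [h1, h.fst_eq x hx, h'.fst_eq x hx]
    ring
  snd_eq x hx := by
    rw [intervalIntegral.integral_add
        ((h.continuous_fst.intervalIntegrable 0 x).const_mul a)
        ((h'.continuous_fst.intervalIntegrable 0 x).const_mul b),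
      intervalIntegral.integral_const_mul, intervalIntegral.integral_const_mul,
      h.snd_eq x hx, h'.snd_eq x hx]
    ring

/-- The difference of the solutions has zero data, so the a priori bound forces it to vanish at X.
-/
lemma SolvesTo.eq_of_initial_eq {w p u q v : ℝ → ℝ} (hw : LocInt w) {X : ℝ}
    (h : SolvesTo w X p u) (h' : SolvesTo w X q v) (h1 : p 0 = q 0) (h2 : u 0 = v 0) :
    p X = q X ∧ u X = v X := by
  have := (h.linear_combination hw h' 1 (-1)).abs_add_abs_le hw
  simp only [h1, h2, one_mul, neg_mul, add_neg_cancel, abs_zero, add_zero, mul_zero,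
    zero_mul] at this
  have h3 := abs_nonneg (p X + -q X)
  have h4 := abs_nonneg (u X + -v X)
  have h5 := abs_eq_zero.1 (le_antisymm (by linarith) h3)
  have h6 := abs_eq_zero.1 (le_antisymm (by linarith) h4)
  exact ⟨by linarith, by linarith⟩

end Anderson

end

noncomputable section

namespace Anderson

/-! ### The propagator -/

/-- The matrix mapping the data `(p 0, u 0)` to `(p x, u x)` for solutions of `p' = w u`,
`u' = p`. -/
def propagator (w : ℝ → ℝ) (x : ℝ) : Matrix (Fin 2) (Fin 2) ℝ :=
  Classical.epsilon fun M => ∀ p u : ℝ → ℝ, SolvesTo w x p u →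
    ![p x, u x] = M.mulVec ![p 0, u 0]

lemma SolvesTo.eq_propagator {w p u : ℝ → ℝ} (hw : LocInt w) {x : ℝ} (h : SolvesTo w x p u) :
    ![p x, u x] = (propagator w x).mulVec ![p 0, u 0] := by
  have hex : ∃ M : Matrix (Fin 2) (Fin 2) ℝ, ∀ p u : ℝ → ℝ, SolvesTo w x p u →
      ![p x, u x] = M.mulVec ![p 0, u 0] := by
    obtain ⟨p₁, u₁, h₁, hp₁, hu₁⟩ := exists_solvesTo hw 1 0
    obtain ⟨p₂, u₂, h₂, hp₂, hu₂⟩ := exists_solvesTo hw 0 1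
    refine ⟨!![p₁ x, p₂ x; u₁ x, u₂ x], fun p u h => ?_⟩
    obtain ⟨e1, e2⟩ := h.eq_of_initial_eq hw
      ((h₁ x).linear_combination hw (h₂ x) (p 0) (u 0)) (by simp [hp₁, hp₂]) (by simp [hu₁, hu₂])
    rw [e1, e2]
    funext i
    fin_cases i <;> simp [Matrix.mulVec, dotProduct, Fin.sum_univ_two, mul_comm]
  exact Classical.epsilon_spec hex p u h

lemma propagator_eq {w p₁ u₁ p₂ u₂ : ℝ → ℝ} (hw : LocInt w) {x : ℝ} (h₁ : SolvesTo w x p₁ u₁)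
    (h₂ : SolvesTo w x p₂ u₂) (hp₁ : p₁ 0 = 1) (hu₁ : u₁ 0 = 0) (hp₂ : p₂ 0 = 0)
    (hu₂ : u₂ 0 = 1) : propagator w x = !![p₁ x, p₂ x; u₁ x, u₂ x] := by
  have e1 := h₁.eq_propagator hw
  have e2 := h₂.eq_propagator hw
  rw [hp₁, hu₁] at e1
  rw [hp₂, hu₂] at e2
  ext i j
  have f1 := congrFun e1 i
  have f2 := congrFun e2 i
  fin_cases i <;> fin_cases j <;>
    simp [Matrix.mulVec, dotProduct, Fin.sum_univ_two] at f1 f2 ⊢ <;> linarith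

lemma SolvesTo.absolutelyContinuous_fst {w p u : ℝ → ℝ} (hw : LocInt w)
    (h : ∀ X, SolvesTo w X p u) (a b : ℝ) : AbsolutelyContinuousOnInterval p a b := by
  have hp : p = fun x => p 0 + ∫ t in 0..x, w t * u t :=
    funext fun x => (h x).fst_eq x right_mem_uIcc
  rw [hp]
  exact (LipschitzOnWith.absolutelyContinuousOnInterval
    ((LipschitzWith.const (p 0)).lipschitzOnWith)).fun_add
    ((hw.mul_continuous (h 0).continuous_snd).absolutelyContinuous 0 a b)

lemma SolvesTo.ae_hasDerivAt_fst {w p u : ℝ → ℝ} (hw : LocInt w) (h : ∀ X, SolvesTo w X p u) :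
    ∀ᵐ x, HasDerivAt p (w x * u x) x := by
  have hp : p = fun x => p 0 + ∫ t in 0..x, w t * u t :=
    funext fun x => (h x).fst_eq x right_mem_uIcc
  filter_upwards [(hw.mul_continuous (h 0).continuous_snd).ae_hasDerivAt_primitive 0] with x hx
  rw [hp]
  exact hx.const_add (p 0)

lemma SolvesTo.hasDerivAt_snd {w p u : ℝ → ℝ} (h : ∀ X, SolvesTo w X p u) (x : ℝ) :
    HasDerivAt u (p x) x := by
  have hu : u = fun x => u 0 + ∫ t in 0..x, p t :=
    funext fun x => (h x).snd_eq x right_mem_uIcc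
  have hp := (h 0).continuous_fst
  rw [hu]
  exact (intervalIntegral.integral_hasDerivAt_right (hp.intervalIntegrable 0 x)
    hp.stronglyMeasurable.stronglyMeasurableAtFilter hp.continuousAt).const_add (u 0)

lemma SolvesTo.absolutelyContinuous_snd {w p u : ℝ → ℝ} (h : ∀ X, SolvesTo w X p u) (a b : ℝ) :
    AbsolutelyContinuousOnInterval u a b := by
  have hu : u = fun x => u 0 + ∫ t in 0..x, p t :=
    funext fun x => (h x).snd_eq x right_mem_uIcc
  rw [hu]
  exact (LipschitzOnWith.absolutelyContinuousOnInterval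
    ((LipschitzWith.const (u 0)).lipschitzOnWith)).fun_add
    ((LocInt.of_continuous (h 0).continuous_fst).absolutelyContinuous 0 a b)

/-- The Wronskian of two solutions is constant. -/
lemma SolvesTo.wronskian_eq {w p u q v : ℝ → ℝ} (hw : LocInt w) (h : ∀ X, SolvesTo w X p u)
    (h' : ∀ X, SolvesTo w X q v) (x : ℝ) : p x * v x - q x * u x = p 0 * v 0 - q 0 * u 0 := by
  -- The derivative of p v is w u v + p q, which is symmetric in the two solutions; subtracting the
  -- two versions leaves the Wronskian.
  have key : ∀ {p u q v : ℝ → ℝ}, (∀ X, SolvesTo w X p u) → (∀ X, SolvesTo w X q v) →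
      ∫ t in 0..x, (w t * u t * v t + p t * q t) = p x * v x - p 0 * v 0 := by
    intro p u q v h h'
    rw [← (SolvesTo.absolutelyContinuous_fst hw h 0 x).integral_deriv_mul_eq_sub
      (SolvesTo.absolutelyContinuous_snd h' 0 x)]
    refine intervalIntegral.integral_congr_ae ?_
    filter_upwards [SolvesTo.ae_hasDerivAt_fst hw h] with t ht _
    rw [ht.deriv, (SolvesTo.hasDerivAt_snd h' t).deriv]
  have h1 := key h h'
  have h2 := key h' h
  have h3 : ∫ t in 0..x, (w t * u t * v t + p t * q t) =
      ∫ t in 0..x, (w t * v t * u t + q t * p t) := by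
    congr 1
    funext t
    ring
  linarith

lemma det_propagator {w : ℝ → ℝ} (hw : LocInt w) (x : ℝ) : (propagator w x).det = 1 := by
  obtain ⟨p₁, u₁, h₁, hp₁, hu₁⟩ := exists_solvesTo hw 1 0
  obtain ⟨p₂, u₂, h₂, hp₂, hu₂⟩ := exists_solvesTo hw 0 1
  have h := SolvesTo.wronskian_eq hw h₁ h₂ x
  rw [hp₁, hu₁, hp₂, hu₂] at h
  rw [propagator_eq hw (h₁ x) (h₂ x) hp₁ hu₁ hp₂ hu₂, Matrix.det_fin_two_of]
  linarith

/-! ### Dependence of the propagator on a coupling constant -/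

lemma expWeight_mono {k k' : ℝ → ℝ} (hk' : LocInt k') (h0 : ∀ t, 0 ≤ k t) (h : ∀ t, k t ≤ k' t)
    (x : ℝ) : expWeight k x ≤ expWeight k' x := by
  refine Real.exp_le_exp.2 (mul_le_mul_of_nonneg_left ?_ zero_le_two)
  exact intervalIntegral.norm_integral_le_abs_of_norm_le
    (Eventually.of_forall fun t => (Real.norm_of_nonneg (h0 t)).trans_le (h t)) (hk' 0 x)

/-- The coefficient `s v - E` of the equation with coupling constant `s`. -/
def coupled (v : ℝ → ℝ) (E s : ℝ) (t : ℝ) : ℝ := s * v t - E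

lemma LocInt.coupled {v : ℝ → ℝ} (hv : LocInt v) (E s : ℝ) : LocInt (coupled v E s) :=
  fun a b => ((hv a b).const_mul s).sub intervalIntegrable_const

/-- A rate dominating the coefficients for all coupling constants bounded by `R`. -/
def maxRate (v : ℝ → ℝ) (E R : ℝ) (t : ℝ) : ℝ := 1 + (R * |v t| + |E|)

lemma LocInt.maxRate {v : ℝ → ℝ} (hv : LocInt v) (E R : ℝ) : LocInt (maxRate v E R) :=
  fun a b => intervalIntegrable_const.add (((hv a b).abs.const_mul R).add intervalIntegrable_const)

lemma expWeight_coupled_le {v : ℝ → ℝ} (hv : LocInt v) (E : ℝ) {R s : ℝ} (hs : |s| ≤ R) (x : ℝ) :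
    expWeight (rate (coupled v E s)) x ≤ expWeight (maxRate v E R) x := by
  refine expWeight_mono (hv.maxRate E R) (rate_nonneg _) (fun t => ?_) x
  have h1 := abs_sub (s * v t) E
  rw [abs_mul] at h1
  have h2 := mul_le_mul_of_nonneg_right hs (abs_nonneg (v t))
  simp only [rate, coupled, maxRate]
  linarith

/-- The difference of the solutions for s' and s solves the system for s' with zero data and forcing
(s' - s) ∫ v U_s. The perturbed estimate makes it O(|s' - s|), with one weight serving all |s'| ≤
|s| + 1. -/
lemma continuous_solution {v : ℝ → ℝ} (hv : LocInt v) (E X : ℝ) {P U : ℝ → ℝ → ℝ}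
    (h : ∀ s, SolvesTo (coupled v E s) X (P s) (U s)) (hP : ∀ s s', P s 0 = P s' 0)
    (hU : ∀ s s', U s 0 = U s' 0) :
    (Continuous fun s => P s X) ∧ Continuous fun s => U s X := by
  have key : ∀ s, Tendsto (fun s' => |P s' X - P s X| + |U s' X - U s X|) (𝓝 s) (𝓝 0) := by
    intro s
    have hcont := (hv.mul_continuous (h s).continuous_snd).continuous_primitive 0
    obtain ⟨c, hc⟩ := isCompact_uIcc.exists_bound_of_continuousOn (s := uIcc 0 X)
      hcont.continuousOn
    have hlim : Tendsto (fun s' => 2 * (|s' - s| * c) * expWeight (maxRate v E (|s| + 1)) X) (𝓝 s)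
        (𝓝 (2 * (|s - s| * c) * expWeight (maxRate v E (|s| + 1)) X)) :=
      Continuous.tendsto (by fun_prop) s
    rw [sub_self, abs_zero, zero_mul, mul_zero, zero_mul] at hlim
    refine squeeze_zero' (Eventually.of_forall fun s' => by positivity) ?_ hlim
    filter_upwards [Metric.ball_mem_nhds s one_pos] with s' hs'
    rw [Metric.mem_ball, Real.dist_eq] at hs'
    have hs'R : |s'| ≤ |s| + 1 := by
      have := abs_add_le s (s' - s)
      rw [add_sub_cancel] at this
      linarith
    have hc0 : 0 ≤ c := (norm_nonneg _).trans (hc 0 left_mem_uIcc)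
    have hw := hv.coupled E s'
    have hw' := hv.coupled E s
    refine (abs_add_abs_le_of_perturbed (f := fun x => (s' - s) * ∫ t in 0..x, v t * U s t)
      (p := fun x => P s' x - P s x) (u := fun x => U s' x - U s x) (c := |s' - s| * c) hw
      ((h s').continuous_fst.sub (h s).continuous_fst)
      ((h s').continuous_snd.sub (h s).continuous_snd) (fun x hx => ?_) (fun x hx => ?_)
      fun x hx => ?_).trans ?_
    · have hi1 := hw.mul_continuous (h s').continuous_snd 0 x
      have hi2 := hw'.mul_continuous (h s).continuous_snd 0 x
      have hi3 : IntervalIntegrable (fun t => coupled v E s' t * (U s' t - U s t)) volume 0 x :=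
        hw.mul_continuous ((h s').continuous_snd.sub (h s).continuous_snd) 0 x
      have hi4 := (hv.mul_continuous (h s).continuous_snd 0 x).const_mul (s' - s)
      have e : (∫ t in 0..x, coupled v E s' t * U s' t) - ∫ t in 0..x, coupled v E s t * U s t =
          (∫ t in 0..x, coupled v E s' t * (U s' t - U s t)) +
            (s' - s) * ∫ t in 0..x, v t * U s t := by
        rw [← intervalIntegral.integral_sub hi1 hi2, ← intervalIntegral.integral_const_mul,
          ← intervalIntegral.integral_add hi3 hi4]
        congr 1
        funext t
        simp only [coupled]
        ring
      rw [(h s').fst_eq x hx, (h s).fst_eq x hx]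
      linarith
    · rw [(h s').snd_eq x hx, (h s).snd_eq x hx, intervalIntegral.integral_sub
        ((h s').continuous_fst.intervalIntegrable 0 x) ((h s).continuous_fst.intervalIntegrable 0 x)]
      ring
    · rw [hP s' s, hU s' s, sub_self, sub_self, abs_zero, zero_add, zero_add, abs_mul]
      exact mul_le_mul_of_nonneg_left (hc x hx) (abs_nonneg _)
    · exact mul_le_mul_of_nonneg_left (expWeight_coupled_le hv E hs'R X) (by positivity)
  constructor <;> refine continuous_iff_continuousAt.2 fun s => ?_ <;>
    refine tendsto_iff_dist_tendsto_zero.2 (squeeze_zero (fun _ => dist_nonneg) (fun s' => ?_)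
      (key s)) <;> rw [Real.dist_eq]
  · linarith [abs_nonneg (U s' X - U s X)]
  · linarith [abs_nonneg (P s' X - P s X)]

/-- Continuity in s is what makes the one-cell matrix a measurable function of the coupling. -/
lemma continuous_propagator_coupled {v : ℝ → ℝ} (hv : LocInt v) (E X : ℝ) :
    Continuous fun s => propagator (coupled v E s) X := by
  choose P₁ U₁ h₁ hP₁ hU₁ using fun s => exists_solvesTo (hv.coupled E s) 1 0
  choose P₂ U₂ h₂ hP₂ hU₂ using fun s => exists_solvesTo (hv.coupled E s) 0 1
  have c₁ := continuous_solution hv E X (fun s => h₁ s X) (fun s s' => by rw [hP₁, hP₁])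
    (fun s s' => by rw [hU₁, hU₁])
  have c₂ := continuous_solution hv E X (fun s => h₂ s X) (fun s s' => by rw [hP₂, hP₂])
    (fun s s' => by rw [hU₂, hU₂])
  refine Continuous.congr (f := fun s => !![P₁ s X, P₂ s X; U₁ s X, U₂ s X]) ?_ fun s =>
    (propagator_eq (hv.coupled E s) (h₁ s X) (h₂ s X) (hP₁ s) (hU₁ s) (hP₂ s) (hU₂ s)).symm
  refine continuous_matrix fun i j => ?_
  fin_cases i <;> fin_cases j
  exacts [c₁.1, c₂.1, c₁.2, c₂.2]

lemma exists_opNorm_le_of_entries (B : ℝ) :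
    ∃ K, ∀ M : Matrix (Fin 2) (Fin 2) ℝ, (∀ i j, |M i j| ≤ B) → opNorm M ≤ K := by
  have hcomp : IsCompact {M : Fin 2 → Fin 2 → ℝ | ∀ i, M i ∈ {r : Fin 2 → ℝ |
      ∀ j, r j ∈ Icc (-B) B}} :=
    isCompact_pi_infinite fun _ => isCompact_pi_infinite fun _ => isCompact_Icc
  have hcont : Continuous fun M : Fin 2 → Fin 2 → ℝ => opNorm (Matrix.of M) := continuous_opNorm
  obtain ⟨K, hK⟩ := hcomp.exists_bound_of_continuousOn hcont.continuousOn
  exact ⟨K, fun M hM => (le_abs_self _).trans (hK M fun i j => abs_le.1 (hM i j))⟩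

/-- The bound at x = 1 is the one required by the matrix theorem; uniformity over [0, 1] serves for
the passage to real x. -/
lemma exists_opNorm_propagator_le {v : ℝ → ℝ} (hv : LocInt v) (E R : ℝ) :
    ∃ K, ∀ s, |s| ≤ R → ∀ x ∈ Icc (0 : ℝ) 1, opNorm (propagator (coupled v E s) x) ≤ K := by
  obtain ⟨B, hB⟩ := isCompact_Icc.exists_bound_of_continuousOn (s := Icc (0 : ℝ) 1)
    (continuous_expWeight (hv.maxRate E R)).continuousOn
  obtain ⟨K, hK⟩ := exists_opNorm_le_of_entries (2 * B)
  refine ⟨K, fun s hs x hx => hK _ fun i j => ?_⟩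
  have hw := hv.coupled E s
  obtain ⟨p₁, u₁, h₁, hp₁, hu₁⟩ := exists_solvesTo hw 1 0
  obtain ⟨p₂, u₂, h₂, hp₂, hu₂⟩ := exists_solvesTo hw 0 1
  have b := (expWeight_coupled_le hv E hs x).trans ((le_abs_self _).trans (hB x hx))
  have b₁ := (h₁ x).abs_add_abs_le hw
  have b₂ := (h₂ x).abs_add_abs_le hw
  rw [hp₁, hu₁, abs_one, abs_zero, add_zero, mul_one] at b₁
  rw [hp₂, hu₂, abs_one, abs_zero, zero_add, mul_one] at b₂
  rw [propagator_eq hw (h₁ x) (h₂ x) hp₁ hu₁ hp₂ hu₂]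
  have := abs_nonneg (p₁ x)
  have := abs_nonneg (p₂ x)
  have := abs_nonneg (u₁ x)
  have := abs_nonneg (u₂ x)
  fin_cases i <;> fin_cases j <;> simp <;> linarith

/-! ### Splitting the propagator at an intermediate point -/

lemma SolvesTo.shift {w w' p u : ℝ → ℝ} (hw : LocInt w) (h : ∀ X, SolvesTo w X p u) {a X : ℝ}
    (hww' : ∀ t ∈ uIcc 0 X, w (a + t) = w' t) :
    SolvesTo w' X (fun t => p (a + t)) (fun t => u (a + t)) where
  continuous_fst := (h 0).continuous_fst.comp (continuous_const.add continuous_id)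
  continuous_snd := (h 0).continuous_snd.comp (continuous_const.add continuous_id)
  fst_eq x hx := by
    have hi := hw.mul_continuous (h 0).continuous_snd
    have e : ∫ t in 0..x, w' t * u (a + t) = ∫ t in a..a + x, w t * u t := by
      have := intervalIntegral.integral_comp_add_left (fun t => w t * u t) a (a := 0) (b := x)
      rw [add_zero] at this
      rw [← this]
      refine intervalIntegral.integral_congr fun t ht => ?_
      rw [hww' t (uIcc_subset_uIcc_left hx ht)]
    rw [e, add_zero, (h _).fst_eq (a + x) right_mem_uIcc, (h _).fst_eq a right_mem_uIcc,
      ← intervalIntegral.integral_add_adjacent_intervals (hi 0 a) (hi a (a + x)), add_assoc]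
  snd_eq x hx := by
    have hi := LocInt.of_continuous (h 0).continuous_fst
    have e := intervalIntegral.integral_comp_add_left p a (a := 0) (b := x)
    rw [add_zero] at e
    rw [e, add_zero, (h _).snd_eq (a + x) right_mem_uIcc, (h _).snd_eq a right_mem_uIcc,
      ← intervalIntegral.integral_add_adjacent_intervals (hi 0 a) (hi a (a + x)), add_assoc]

/-- Uniqueness of solutions gives the cocycle property. The translated coefficient has to agree with
w' only on the interval crossed, so w' may come from a single cell. -/
lemma propagator_add {w w' : ℝ → ℝ} (hw : LocInt w) (hw' : LocInt w') {a x : ℝ}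
    (hww' : ∀ t ∈ uIcc 0 x, w (a + t) = w' t) :
    propagator w (a + x) = propagator w' x * propagator w a := by
  refine matrix_ext_of_mulVec fun c d => ?_
  obtain ⟨p, u, h, rfl, rfl⟩ := exists_solvesTo hw c d
  have h1 := (SolvesTo.shift hw h hww').eq_propagator hw'
  simp only [add_zero] at h1
  rw [← Matrix.mulVec_mulVec, ← (h a).eq_propagator hw, ← (h (a + x)).eq_propagator hw, h1]

lemma propagator_zero {w : ℝ → ℝ} (hw : LocInt w) : propagator w 0 = 1 := by
  refine matrix_ext_of_mulVec fun c d => ?_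
  obtain ⟨p, u, h, rfl, rfl⟩ := exists_solvesTo hw c d
  rw [← (h 0).eq_propagator hw, Matrix.one_mulVec]

/-! ### The continuum case -/

namespace Continuum

variable {ν : Measure ℝ} {v : ℝ → ℝ}

/-- Forward, both u and u' are recovered by integrating their derivatives, for u' by absolute
continuity. Backward, a primitive is differentiable a.e. with the integrand as derivative. -/
lemma isSolution_iff {V : ℝ → ℝ} (hV : LocInt V) (E : ℝ) {u : ℝ → ℝ} :
    IsSolution V E u ↔ ∀ X, SolvesTo (fun t => V t - E) X (deriv u) u := by
  have hw : LocInt fun t => V t - E := fun a b => (hV a b).sub intervalIntegrable_const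
  constructor
  · rintro ⟨hd, hac, hae⟩ X
    have hp : Continuous (deriv u) := by
      refine continuous_iff_continuousAt.2 fun x => ?_
      refine (hac (x - 1) (x + 1)).continuousOn.continuousAt ?_
      rw [uIcc_of_le (by linarith)]
      exact Icc_mem_nhds (by linarith) (by linarith)
    refine ⟨hp, hd.continuous, fun x _ => ?_, fun x _ => ?_⟩
    · have h1 : ∫ t in 0..x, (V t - E) * u t = ∫ t in 0..x, deriv (deriv u) t := by
        refine intervalIntegral.integral_congr_ae ?_
        filter_upwards [hae] with t ht _
        linarith
      rw [h1, (hac 0 x).integral_deriv_eq_sub]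
      ring
    · rw [intervalIntegral.integral_deriv_eq_sub (fun t _ => hd t) (hp.intervalIntegrable 0 x)]
      ring
  · intro h
    refine ⟨fun x => (SolvesTo.hasDerivAt_snd h x).differentiableAt,
      SolvesTo.absolutelyContinuous_fst hw h, ?_⟩
    filter_upwards [SolvesTo.ae_hasDerivAt_fst hw h] with x hx
    rw [hx.deriv]
    ring

lemma exists_isSolution {V : ℝ → ℝ} (hV : LocInt V) (E a b : ℝ) :
    ∃ u, IsSolution V E u ∧ deriv u 0 = a ∧ u 0 = b := by
  obtain ⟨p, u, h, hp, hu⟩ :=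
    exists_solvesTo (w := fun t => V t - E) (fun a b => (hV a b).sub intervalIntegrable_const) a b
  have hd : deriv u = p := funext fun x => (SolvesTo.hasDerivAt_snd h x).deriv
  exact ⟨u, (isSolution_iff hV E).2 (by rwa [hd]), by rw [hd, hp], hu⟩

lemma isTransferMatrix_propagator {V : ℝ → ℝ} (hV : LocInt V) (E x : ℝ) :
    IsTransferMatrix V E x (propagator (fun t => V t - E) x) := fun _ hu =>
  ((isSolution_iff hV E).1 hu x).eq_propagator fun a b => (hV a b).sub intervalIntegrable_const

lemma existsUnique_isTransferMatrix {V : ℝ → ℝ} (hV : LocInt V) (E x : ℝ) :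
    ∃! M, IsTransferMatrix V E x M := by
  refine ⟨_, isTransferMatrix_propagator hV E x, fun N hN => matrix_ext_of_mulVec fun a b => ?_⟩
  obtain ⟨u, hu, rfl, rfl⟩ := exists_isSolution hV E a b
  rw [← hN u hu, ← isTransferMatrix_propagator hV E x u hu]

lemma transferMatrix_eq_propagator {V : ℝ → ℝ} (hV : LocInt V) (E x : ℝ) :
    transferMatrix V E x = propagator (fun t => V t - E) x :=
  (existsUnique_isTransferMatrix hV E x).unique
    (Classical.epsilon_spec (existsUnique_isTransferMatrix hV E x).exists)
    (isTransferMatrix_propagator hV E x)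

lemma locInt_potential (hv : IntegrableOn v (Ioo 0 1)) (ω : Omega ν) :
    LocInt (potential v ω) := by
  intro a b
  -- On [-N, N] only cells with index in [-N, N] contribute, so the series is a finite sum of
  -- integrable functions there.
  obtain ⟨N, hN⟩ := exists_nat_gt (max |a| |b|)
  have hint : ∀ n : ℤ, Integrable fun x => (ω n : ℝ) * (Ioo (0 : ℝ) 1).indicator v (x - n) :=
    fun n => (((integrable_indicator_iff measurableSet_Ioo).2 hv).comp_sub_right (n : ℝ)).const_mul _
  have hsum := (integrable_finsetSum (Finset.Icc (-N : ℤ) N) fun n _ => hint n).intervalIntegrable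
    (a := a) (b := b)
  refine hsum.congr fun x hx => ?_
  have hxN : |x| ≤ N := by
    have h1 := uIoc_subset_uIcc hx
    have ha : a ∈ Icc (-(N : ℝ)) N := abs_le.1 ((le_max_left _ _).trans hN.le)
    have hb : b ∈ Icc (-(N : ℝ)) N := abs_le.1 ((le_max_right _ _).trans hN.le)
    exact abs_le.2 (uIcc_subset_Icc ha hb h1)
  rw [abs_le] at hxN
  refine (tsum_eq_sum fun n hn => ?_).symm
  rw [indicator_of_notMem, mul_zero]
  rintro ⟨h1, h2⟩
  refine hn (Finset.mem_Icc.2 ⟨?_, ?_⟩)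
  · have : (-N - 1 : ℝ) < n := by linarith
    have : (-N - 1 : ℤ) < n := by exact_mod_cast this
    omega
  · have : (n : ℝ) < N := by linarith
    have : n < (N : ℤ) := by exact_mod_cast this
    exact this.le

/-- Both endpoints are allowed: the cells are open, so all terms vanish at integers and the identity
holds pointwise on the closed cell. -/
lemma potential_add (ω : Omega ν) (n : ℤ) {t : ℝ} (ht : t ∈ Icc (0 : ℝ) 1) :
    potential v ω (n + t) = ω n * (Ioo (0 : ℝ) 1).indicator v t := by
  unfold potential
  rw [tsum_eq_single n]
  · rw [add_sub_cancel_left]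
  · intro m hm
    rw [indicator_of_notMem, mul_zero]
    rintro ⟨h1, h2⟩
    rcases lt_or_gt_of_ne hm with h | h
    · have : (m : ℝ) + 1 ≤ n := by exact_mod_cast h
      linarith [ht.1]
    · have : (n : ℝ) + 1 ≤ m := by exact_mod_cast h
      linarith [ht.2]

lemma locInt_indicator (hv : IntegrableOn v (Ioo 0 1)) :
    LocInt ((Ioo (0 : ℝ) 1).indicator v) := fun _ _ =>
  ((integrable_indicator_iff measurableSet_Ioo).2 hv).intervalIntegrable

lemma transferMatrix_add (hv : IntegrableOn v (Ioo 0 1)) (ω : Omega ν) (E : ℝ) (n : ℕ) {t : ℝ}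
    (ht : t ∈ Icc (0 : ℝ) 1) :
    transferMatrix (potential v ω) E (n + t) =
      propagator (coupled ((Ioo (0 : ℝ) 1).indicator v) E (ω n)) t *
        transferMatrix (potential v ω) E n := by
  have hV := locInt_potential hv ω
  rw [transferMatrix_eq_propagator hV, transferMatrix_eq_propagator hV]
  refine propagator_add (fun a b => (hV a b).sub intervalIntegrable_const)
    ((locInt_indicator hv).coupled E (ω n)) fun x hx => ?_
  rw [uIcc_of_le ht.1] at hx
  have := potential_add (v := v) ω n ⟨hx.1, hx.2.trans ht.2⟩
  rw [Int.cast_natCast] at this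
  rw [this, coupled]

lemma transferMatrix_eq_cocycle (hv : IntegrableOn v (Ioo 0 1)) (ω : Omega ν) (E : ℝ) (n : ℕ) :
    transferMatrix (potential v ω) E n = cocycle
      (fun s : ν.support => propagator (coupled ((Ioo (0 : ℝ) 1).indicator v) E s) 1) ω n := by
  induction n with
  | zero =>
    have hV := locInt_potential hv ω
    rw [transferMatrix_eq_propagator hV, Nat.cast_zero,
      propagator_zero fun a b => (hV a b).sub intervalIntegrable_const]
    rfl
  | succ n ih =>
    rw [cocycle, ← ih, Nat.cast_succ, transferMatrix_add hv ω E n (right_mem_Icc.2 zero_le_one)]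

end Continuum

/-- Interpolation of a growth rate from the integers to the reals. -/
lemma tendsto_div_of_tendsto_nat {L : ℝ → ℝ} {γ C : ℝ}
    (h : Tendsto (fun n : ℕ => L n / n) atTop (𝓝 γ))
    (hC : ∀ (n : ℕ) (t : ℝ), t ∈ Icc (0 : ℝ) 1 → |L (n + t) - L n| ≤ C) :
    Tendsto (fun x => L x / x) atTop (𝓝 γ) := by
  have hfloor : Tendsto (fun x : ℝ => ⌊x⌋₊) atTop atTop := tendsto_nat_floor_atTop
  -- Uses L x / x = (L ⌊x⌋ / ⌊x⌋) (⌊x⌋ / x) + (L x - L ⌊x⌋) / x.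
  have h1 := (h.comp hfloor).mul (tendsto_nat_floor_div_atTop (R := ℝ))
  have h2 : Tendsto (fun x : ℝ => (L x - L ⌊x⌋₊) / x) atTop (𝓝 0) := by
    refine squeeze_zero_norm' ?_ (tendsto_const_nhds.div_atTop tendsto_id : Tendsto
      (fun x : ℝ => C / x) atTop (𝓝 0))
    filter_upwards [eventually_gt_atTop 0] with x hx
    rw [norm_div, Real.norm_of_nonneg hx.le, Real.norm_eq_abs]
    have := hC ⌊x⌋₊ (x - ⌊x⌋₊) ⟨sub_nonneg.2 (Nat.floor_le hx.le), by
      linarith [Nat.lt_floor_add_one x]⟩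
    rw [add_sub_cancel] at this
    gcongr
  have h3 := h1.add h2
  rw [mul_one, add_zero] at h3
  refine h3.congr' ?_
  filter_upwards [eventually_ge_atTop 1] with x hx
  have hn : ((⌊x⌋₊ : ℕ) : ℝ) ≠ 0 := by
    exact_mod_cast (Nat.floor_pos.2 hx).ne'
  simp only [Function.comp]
  rw [div_mul_div_cancel₀ hn, ← add_div, add_sub_cancel]

/-- The continuum case of the main theorem. -/
theorem continuum_lyapunov (ν : Measure ℝ) [IsProbabilityMeasure ν] (hν : IsCompact ν.support)
    {v : ℝ → ℝ} (hv : IntegrableOn v (Ioo 0 1)) (E : ℝ) :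
    ∃ γ : ℝ, 0 ≤ γ ∧ ∀ᵐ ω ∂(mu ν),
      Tendsto (Continuum.growthRate (Continuum.potential v ω) E) atTop (𝓝 γ) := by
  have hv0 := Continuum.locInt_indicator hv
  have hc := continuous_propagator_coupled hv0 E 1
  obtain ⟨R, hR⟩ := hν.isBounded.exists_norm_le
  obtain ⟨K, hK⟩ := exists_opNorm_propagator_le hv0 E R
  have hdet : ∀ s x, (propagator (coupled ((Ioo (0 : ℝ) 1).indicator v) E s) x).det = 1 :=
    fun s x => det_propagator (hv0.coupled E s) x
  obtain ⟨γ, hγ, h⟩ := exists_tendsto_logNorm (siteMeasure ν) (measurable_entry hc)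
    (fun s => hdet s 1) (fun s => hK s (hR s s.2) 1 (right_mem_Icc.2 zero_le_one))
  refine ⟨γ, hγ, h.mono fun ω hω => ?_⟩
  have hlim := tendsto_div_of_tendsto_nat (γ := γ) (C := Real.log K)
    (L := fun x => Real.log (opNorm (Continuum.transferMatrix (Continuum.potential v ω) E x)))
    (hω.congr fun n => by rw [← Continuum.transferMatrix_eq_cocycle hv ω E n]) fun n t ht => ?_
  · refine hlim.congr fun x => ?_
    rw [Continuum.growthRate, one_div_mul_eq_div]
  · have hdetM : ∀ x, (Continuum.transferMatrix (Continuum.potential v ω) E x).det = 1 := fun x => by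
      have hV := Continuum.locInt_potential hv ω
      rw [Continuum.transferMatrix_eq_propagator hV]
      exact det_propagator (fun a b => (hV a b).sub intervalIntegrable_const) x
    have hpos : ∀ x, 0 < opNorm (Continuum.transferMatrix (Continuum.potential v ω) E x) :=
      fun x => one_pos.trans_le (one_le_opNorm (hdetM x))
    have hB := hK (ω n) (hR _ (ω n).2) t ht
    have hB1 := one_le_opNorm (hdet (ω n) t)
    have hKpos : 0 < K := by linarith
    have hadd := Continuum.transferMatrix_add hv ω E n ht
    -- Multiplication by a unimodular matrix of norm at most K changes the norm by a factor between
    -- 1 / K and K, so the logarithm moves by at most log K.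
    have h1 := opNorm_mul_le (propagator (coupled ((Ioo (0 : ℝ) 1).indicator v) E (ω n)) t)
      (Continuum.transferMatrix (Continuum.potential v ω) E n)
    have h2 := opNorm_le_of_mul_left (hdet (ω n) t)
      (Continuum.transferMatrix (Continuum.potential v ω) E n)
    rw [← hadd] at h1 h2
    have h3 := Real.log_le_log (hpos _) (h1.trans (mul_le_mul_of_nonneg_right hB (hpos _).le))
    have h4 := Real.log_le_log (hpos _) (h2.trans (mul_le_mul_of_nonneg_right hB (hpos _).le))
    rw [Real.log_mul hKpos.ne' (hpos _).ne'] at h3 h4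
    rw [abs_le]
    constructor <;> linarith

end Anderson

end

theorem mainTheorem10 (ν : Measure ℝ) [IsProbabilityMeasure ν] (hν : IsCompact ν.support) :
    -- the discrete case
    (∀ E : ℝ,
      (∀ (ω : Anderson.Omega ν) (n : ℤ), ∃! M : Matrix (Fin 2) (Fin 2) ℝ,
        Anderson.Discrete.IsTransferMatrix (Anderson.Discrete.potential ω) E n M) ∧
      ∃ γ : ℝ, 0 ≤ γ ∧ ∀ᵐ ω ∂(Anderson.mu ν),
        Tendsto (fun n : ℕ => 1 / (n : ℝ) * Real.log (Anderson.opNorm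
          (Anderson.Discrete.transferMatrix (Anderson.Discrete.potential ω) E n)))
          atTop (𝓝 γ) ∧
        Anderson.Discrete.HasLyapunovBehavior (Anderson.Discrete.potential ω) E ∧
        Anderson.Discrete.lyapunovExponent (Anderson.Discrete.potential ω) E = γ) ∧
    -- the continuum case
    (∀ v : ℝ → ℝ, IntegrableOn v (Ioo 0 1) → ¬ (v =ᵐ[volume.restrict (Ioo 0 1)] 0) →
      ∀ E : ℝ,
      (∀ (ω : Anderson.Omega ν) (x : ℝ), ∃! M : Matrix (Fin 2) (Fin 2) ℝ,
        Anderson.Continuum.IsTransferMatrix (Anderson.Continuum.potential v ω) E x M) ∧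
      ∃ γ : ℝ, 0 ≤ γ ∧ ∀ᵐ ω ∂(Anderson.mu ν),
        Tendsto (fun x : ℝ => 1 / x * Real.log (Anderson.opNorm
          (Anderson.Continuum.transferMatrix (Anderson.Continuum.potential v ω) E x)))
          atTop (𝓝 γ) ∧
        Anderson.Continuum.HasLyapunovBehavior (Anderson.Continuum.potential v ω) E ∧
        Anderson.Continuum.lyapunovExponent (Anderson.Continuum.potential v ω) E = γ) := by
  refine ⟨fun E => ⟨fun ω n => Anderson.Discrete.existsUnique_isTransferMatrix _ E n, ?_⟩,
    fun v hv _ E => ⟨fun ω x => Anderson.Continuum.existsUnique_isTransferMatrix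
      (Anderson.Continuum.locInt_potential hv ω) E x, ?_⟩⟩
  · obtain ⟨γ, hγ, h⟩ := Anderson.discrete_lyapunov ν hν E
    exact ⟨γ, hγ, h.mono fun ω hω => ⟨hω, ⟨γ, hω⟩, hω.limUnder_eq⟩⟩
  · obtain ⟨γ, hγ, h⟩ := Anderson.continuum_lyapunov ν hν hv E
    exact ⟨γ, hγ, h.mono fun ω hω => ⟨hω, ⟨γ, hω⟩, hω.limUnder_eq⟩⟩
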